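/- Let $\tau\in\mathbb{C}$ with $\operatorname{Im}\tau>0$, let $\Lambda=\mathbb{Z}+\tau\mathbb{Z}$, and let $P=\{s+t\tau: 0\le s,t<1\}$ be the fundamental domain of $\mathbb{C}/\Lambda$. A rank-$r$ flat factor of automorphy ($r\ge 1$) is a homomorphism $\xi:\Lambda\to GL(r,\mathbb{C})$. Two such, $\xi$ and $\eta$, are equivalent if there is a holomorphic $h:\mathbb{C}\to GL(r,\mathbb{C})$ with $h(u+\lambda)\,\xi(\lambda)=\eta(\lambda)\,h(u)$ for all $\lambda\in\Lambda$, $u\in\mathbb{C}$. A trivialization of $\xi$ is an $r\times r$ matrix function $F$, meromorphic on $\mathbb{C}$, with $\det F\not\equiv0$ and $F(u+\lambda)=\xi(\lambda)F(u)$ for all $\lambda\in\Lambda$. A simple null-pole data set of size $N\ge 0$, $$\mathcal{D}:(z_1,\mathbf{x}_1),\dots,(z_N,\mathbf{x}_N):(w_1,\mathbf{y}_1),\dots,(w_N,\mathbf{y}_N),$$ consists of $2N$ distinct points $z_1,\dots,z_N,w_1,\dots,w_N$ of $P$ and nonzero column vectors $\mathbf{x}_i,\mathbf{y}_i\in\mathbb{C}^r$.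 A meromorphic $r\times r$ matrix function $F$ interpolates $\mathcal{D}$ if 1. on $P$ the divisor of $\det F$ is $z_1+\cdots+z_N-w_1-\cdots-w_N$; 2. the only poles of entries of $F$ are at most simple poles at points of $w_i+\Lambda$, $i=1,\dots,N$; 3. $F$ is analytic at the points of $z_i+\Lambda$, and $\mathbf{x}_i$ spans the right kernel of $F$ at these points, $i=1,\dots,N$; 4. $F^{-1}$ is analytic at the points of $w_i+\Lambda$, and $\mathbf{y}_i^{\top}$ spans the left kernel of $F^{-1}$ at these points, $i=1,\dots,N$. For $s\ge1$ let $J_1^{(s)}$ be the $s\times s$ Jordan block with eigenvalue $1$, and let $\xi_{J_1^{(s)}}(m+n\tau)=(J_1^{(s)})^n$. **Theorem.** Let $r\ge1$ and let $\xi$ be a rank-$r$ flat factor of automorphy over $\mathbb{C}/\Lambda$. Then there are a simple null-pole data set $\mathcal{D}$ of some size $N<2r$ and a trivialization $F$ of $\xi$ that interpolates $\mathcal{D}$. If, moreover, $\xi$ has no direct summand equivalent to $\xi_{J_1^{(s)}}$ for any $s\ge1$ (that is, $\xi$ is not equivalent to $\xi_{J_1^{(s)}}\oplus\eta$ for any $s\ge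 1$ and any flat factor of automorphy $\eta$ of rank $r-s$), then there are such $\mathcal{D}$ and $F$ with $N=r$. -/

import Mathlib

open scoped Topology

namespace EllipticFlat

noncomputable section

/-- The lattice `ℤ + τℤ`, i.e. the group of deck transformations `u ↦ u + l` of the universal
cover `ℂ → ℂ/(ℤ + τℤ)`. -/
def lattice (τ : UpperHalfPlane) : AddSubgroup ℂ where
  carrier := Set.range fun p : ℤ × ℤ => (p.1 : ℂ) + p.2 * (τ : ℂ)
  zero_mem' := ⟨(0, 0), by simp⟩
  add_mem' := by
    rintro _ _ ⟨p, rfl⟩ ⟨q, rfl⟩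
    exact ⟨(p.1 + q.1, p.2 + q.2), by push_cast; ring⟩
  neg_mem' := by
    rintro _ ⟨p, rfl⟩
    exact ⟨(-p.1, -p.2), by push_cast; ring⟩

/-- The half-open fundamental parallelogram of `ℤ + τℤ`. -/
def fundamentalDomain (τ : UpperHalfPlane) : Set ℂ :=
  {u | ∃ s ∈ Set.Ico (0 : ℝ) 1, ∃ t ∈ Set.Ico (0 : ℝ) 1, u = (s : ℂ) + (t : ℂ) * (τ : ℂ)}

/-- The coordinate `n` of the lattice point `m + nτ`. -/
def tauCoord (τ : UpperHalfPlane) (l : lattice τ) : ℤ := round ((l : ℂ).im / τ.im)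

theorem tauCoord_spec (τ : UpperHalfPlane) (l : lattice τ) (m n : ℤ)
    (h : (l : ℂ) = (m : ℂ) + n * (τ : ℂ)) : tauCoord τ l = n := by
  have hτ : τ.im ≠ 0 := τ.im_ne_zero
  have him : (l : ℂ).im = n * τ.im := by rw [h]; simp
  rw [tauCoord, him, mul_div_assoc, div_self hτ, mul_one, round_intCast]

theorem tauCoord_zero (τ : UpperHalfPlane) : tauCoord τ 0 = 0 :=
  tauCoord_spec τ 0 0 0 (by simp)

theorem tauCoord_add (τ : UpperHalfPlane) (k l : lattice τ) :
    tauCoord τ (k + l) = tauCoord τ k + tauCoord τ l := by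
  obtain ⟨p, hp⟩ := k.2
  obtain ⟨q, hq⟩ := l.2
  simp only at hp hq
  rw [tauCoord_spec τ k p.1 p.2 hp.symm, tauCoord_spec τ l q.1 q.2 hq.symm]
  refine tauCoord_spec τ (k + l) (p.1 + q.1) (p.2 + q.2) ?_
  rw [AddSubgroup.coe_add, ← hp, ← hq]
  push_cast
  ring

/-- A flat factor of automorphy over `ℂ/(ℤ + τℤ)` (with rows and columns indexed by `n`):
a representation of `ℤ + τℤ` in the invertible complex matrices. -/
abbrev FlatFactor (τ : UpperHalfPlane) (n : Type) [Fintype n] [DecidableEq n] : Type :=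
  Multiplicative (lattice τ) →* GL n ℂ

/-- The matrix `ξ(l)` of a flat factor of automorphy at a lattice point `l`. -/
abbrev FlatFactor.mat {τ : UpperHalfPlane} {n : Type} [Fintype n] [DecidableEq n]
    (ξ : FlatFactor τ n) (l : lattice τ) : Matrix n n ℂ :=
  (ξ (Multiplicative.ofAdd l) : GL n ℂ).val

/-- The normalized flat factor `ξ_V`, with `ξ_V(1) = I` and `ξ_V(τ) = V`, that is
`ξ_V(m + nτ) = V ^ n`. -/
def normalizedFactor (τ : UpperHalfPlane) {n : Type} [Fintype n] [DecidableEq n] (V : GL n ℂ) :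
    FlatFactor τ n where
  toFun l := V ^ tauCoord τ l.toAdd
  map_one' := by
    change V ^ tauCoord τ 0 = 1
    rw [tauCoord_zero, zpow_zero]
  map_mul' k l := by
    change V ^ tauCoord τ (k.toAdd + l.toAdd) = _
    rw [tauCoord_add, zpow_add]

/-- The `s × s` Jordan block with eigenvalue `α` and ones on the superdiagonal. -/
def jordanBlock (s : ℕ) (α : ℂ) : Matrix (Fin s) (Fin s) ℂ :=
  Matrix.of fun i j => if i = j then α else if (i : ℕ) + 1 = j then 1 else 0

theorem det_jordanBlock (s : ℕ) (α : ℂ) : (jordanBlock s α).det = α ^ s := by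
  rw [Matrix.det_of_isUpperTriangular]
  · simp [jordanBlock]
  · intro i j hij
    have h : (j : ℕ) < i := hij
    have h1 : i ≠ j := by rintro rfl; exact lt_irrefl _ h
    have h2 : (i : ℕ) + 1 ≠ j := by omega
    simp [jordanBlock, h1, h2]

/-- The Jordan block with nonzero eigenvalue as an invertible matrix. -/
def jordanGL (s : ℕ) (α : ℂˣ) : GL (Fin s) ℂ :=
  Matrix.GeneralLinearGroup.mkOfDetNeZero (jordanBlock s α)
    (by rw [det_jordanBlock]; exact pow_ne_zero _ α.ne_zero)

/-- The flat factor `ξ_J` for `J` the `s × s` Jordan block with eigenvalue `α ≠ 0`. -/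
def jordanFactor (τ : UpperHalfPlane) (s : ℕ) (α : ℂˣ) : FlatFactor τ (Fin s) :=
  normalizedFactor τ (jordanGL s α)

/-- The block diagonal matrix of two invertible matrices. -/
def blockDiagGL {m n : Type} [Fintype m] [DecidableEq m] [Fintype n] [DecidableEq n]
    (A : GL m ℂ) (B : GL n ℂ) : GL (m ⊕ n) ℂ where
  val := Matrix.fromBlocks A.val 0 0 B.val
  inv := Matrix.fromBlocks A.inv 0 0 B.inv
  val_inv := by rw [Matrix.fromBlocks_multiply]; simp
  inv_val := by rw [Matrix.fromBlocks_multiply]; simp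

/-- The direct sum of two flat factors of automorphy. -/
def FlatFactor.directSum {τ : UpperHalfPlane} {m n : Type} [Fintype m] [DecidableEq m]
    [Fintype n] [DecidableEq n] (ξ : FlatFactor τ m) (η : FlatFactor τ n) :
    FlatFactor τ (m ⊕ n) where
  toFun l := blockDiagGL (ξ l) (η l)
  map_one' := by
    apply Units.ext
    simp [blockDiagGL]
  map_mul' k l := by
    apply Units.ext
    simp [blockDiagGL, Matrix.fromBlocks_multiply]

/-- Renaming of the index set of a flat factor of automorphy. -/
def FlatFactor.reindex {τ : UpperHalfPlane} {m n : Type} [Fintype m] [DecidableEq m]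
    [Fintype n] [DecidableEq n] (e : m ≃ n) (ξ : FlatFactor τ m) : FlatFactor τ n :=
  (Units.map (Matrix.reindexAlgEquiv ℂ ℂ e : Matrix m m ℂ →* Matrix n n ℂ)).comp ξ

/-- Holomorphic equivalence of factors of automorphy: there is a holomorphic `h : ℂ → GL(n, ℂ)`
with `h(u + l) ξ(l) = η(l) h(u)`. -/
def FlatFactor.Equivalent {τ : UpperHalfPlane} {n : Type} [Fintype n] [DecidableEq n]
    (ξ η : FlatFactor τ n) : Prop :=
  ∃ h : ℂ → GL n ℂ, (∀ i j, Differentiable ℂ fun u => (h u).val i j) ∧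
    ∀ (l : lattice τ) (u : ℂ), (h (u + l)).val * ξ.mat l = η.mat l * (h u).val

/-- `ξ` has a direct summand equivalent to `ζ`: it is equivalent to `ζ ⊕ η` for some flat `η`
(of rank possibly zero). -/
def FlatFactor.HasSummand {τ : UpperHalfPlane} {r s : ℕ}
    (ξ : FlatFactor τ (Fin r)) (ζ : FlatFactor τ (Fin s)) : Prop :=
  ∃ (t : ℕ) (e : Fin s ⊕ Fin t ≃ Fin r) (η : FlatFactor τ (Fin t)),
    ξ.Equivalent ((ζ.directSum η).reindex e)

/-- `F` is a meromorphic matrix function on `ℂ` (values at isolated points are immaterial). -/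
def IsMeromorphicMatrix {r : ℕ} (F : ℂ → Matrix (Fin r) (Fin r) ℂ) : Prop :=
  ∀ i j u, MeromorphicAt (fun v => F v i j) u

/-- `F` is a meromorphic matrix trivialization of `ξ`: a nondegenerate meromorphic matrix function
with `F(u + l) = ξ(l) F(u)`, an identity of meromorphic functions. -/
structure IsTrivialization {τ : UpperHalfPlane} {r : ℕ} (ξ : FlatFactor τ (Fin r))
    (F : ℂ → Matrix (Fin r) (Fin r) ℂ) : Prop where
  meromorphic : IsMeromorphicMatrix F
  nondegenerate : ¬ ((fun u => (F u).det) =ᶠ[Filter.codiscrete ℂ] fun _ => 0)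
  automorphic : ∀ l : lattice τ,
    (fun u => F (u + l)) =ᶠ[Filter.codiscrete ℂ] fun u => ξ.mat l * F u

/-- `F` is analytic at `u` (after removing a removable singularity), with value `A` there. -/
def AnalyticWithValue {r : ℕ} (F : ℂ → Matrix (Fin r) (Fin r) ℂ) (u : ℂ)
    (A : Matrix (Fin r) (Fin r) ℂ) : Prop :=
  ∃ G : ℂ → Matrix (Fin r) (Fin r) ℂ, (∀ i j, AnalyticAt ℂ (fun v => G v i j) u) ∧
    G =ᶠ[𝓝[≠] u] F ∧ G u = A

/-- Simple null-pole data `(z₁,x₁),…,(z_N,x_N) : (w₁,y₁),…,(w_N,y_N)` of size `N`: `2N` distinct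
points of the fundamental domain and nonzero vectors in `ℂ^r`. -/
structure SimpleNullPoleData (τ : UpperHalfPlane) (r N : ℕ) where
  z : Fin N → ℂ
  w : Fin N → ℂ
  x : Fin N → Fin r → ℂ
  y : Fin N → Fin r → ℂ
  z_mem : ∀ k, z k ∈ fundamentalDomain τ
  w_mem : ∀ k, w k ∈ fundamentalDomain τ
  distinct : Function.Injective (Sum.elim z w)
  x_ne_zero : ∀ k, x k ≠ 0
  y_ne_zero : ∀ k, y k ≠ 0

/-- The meromorphic matrix function `F` interpolates the simple null-pole data `D`. -/
structure Interpolates {τ : UpperHalfPlane} {r N : ℕ} (D : SimpleNullPoleData τ r N)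
    (F : ℂ → Matrix (Fin r) (Fin r) ℂ) : Prop where
  meromorphic : IsMeromorphicMatrix F
  /-- On the fundamental domain, `(det F) = z₁ + ⋯ + z_N - w₁ - ⋯ - w_N`. -/
  divisor_det : ∀ u ∈ fundamentalDomain τ,
    meromorphicOrderAt (fun v => (F v).det) u =
      (((∑ k, if D.z k = u then 1 else 0) - ∑ k, if D.w k = u then 1 else 0 : ℤ) : WithTop ℤ)
  /-- The only poles of entries of `F` are simple poles at points of `w_k + ℤ + τℤ`. -/
  poles : ∀ i j u, meromorphicOrderAt (fun v => F v i j) u < 0 →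
    (∃ k, ∃ l : lattice τ, u = D.w k + l) ∧
      meromorphicOrderAt (fun v => F v i j) u = ((-1 : ℤ) : WithTop ℤ)
  /-- `F` is analytic at the points of `z_k + ℤ + τℤ` and `x_k` spans its right kernel there. -/
  zeros : ∀ k, ∀ l : lattice τ, ∃ A, AnalyticWithValue F (D.z k + l) A ∧
    LinearMap.ker A.mulVecLin = Submodule.span ℂ {D.x k}
  /-- `F⁻¹` is analytic at the points of `w_k + ℤ + τℤ` and `y_kᵀ` spans its left kernel there. -/
  inv_zeros : ∀ k, ∀ l : lattice τ, ∃ B, AnalyticWithValue (fun u => (F u)⁻¹) (D.w k + l) B ∧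
    LinearMap.ker B.vecMulLinear = Submodule.span ℂ {D.y k}

end

end EllipticFlat

open scoped Topology

namespace EllipticFlat
noncomputable section

/-! Normalize first. The matrix `ξ(1)` has a logarithm `L` commuting with everything that commutes
with `ξ(1)`, in particular with `ξ(τ)`. The gauge `exp (-u L)`, followed by a constant conjugation,
turns `ξ` into `ξ_V` with `V` upper triangular (`exists_equivalent_normalizedFactor`).

Substituting `V⁻¹` into the product formula of the scalar theta function `σ` gives an entire matrix
function `Θ` with `Θ(u + 1) = Θ(u)` and `Θ(u + τ) = -exp(-2πiu) V Θ(u)`. Hence each column of `Θ/σ`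
is a section of `ξ_V`. It is triangular with diagonal entries `σ(u + c_j)/σ(u)`, where `V_jj =
exp(-2πi c_j)`.

A section whose last nonzero entry is the `j`-th, with `n` simple zeros and at most `n` simple poles
there, is what `HasColumn` records. If `c_j ∉ Λ`, the `j`-th column of `Θ/σ` has `n = 1`
(`hasColumn_one`). For arbitrary `c_j`, a translated column times a further quotient of theta
functions has `n = 2` (`hasColumn_two`). If `c_j ∈ Λ` for the first index, a constant eigenvector
times an exponential has `n = 0` (`hasColumn_zero`).

Multipliers are constant, so columns can be translated independently until all zeros and poles are
distinct modulo `Λ`. The determinant is the product of the diagonal, so its zeros are simple, and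
each forces a one-dimensional kernel (`exists_ker_eq_span_singleton`). Each pole sits in one column,
which makes the left kernel of the inverse a coordinate line. This is
`exists_interpolates_divColumns`, applied in `exists_interpolates_of_hasColumn`.

At most one zero from the first column and two from each other column give `N ≤ 2r - 1`. If some
`c_j` lies in `Λ`, a scalar exponential gauge moves the eigenvalue `V_jj` to `1`, and a Jordan block
splits off (`hasSummand_of_det_eq_zero`). Without such a summand every column has `n = 1`, so `N =
r`. -/

/-! ### Logarithms in complex Banach algebras. -/

/-- Inverse function theorem: the derivative of the exponential at `0` is the identity. -/
theorem range_exp_mem_nhds_one {𝔸 : Type*} [NormedRing 𝔸] [NormedAlgebra ℂ 𝔸] [CompleteSpace 𝔸] :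
    Set.range (NormedSpace.exp : 𝔸 → 𝔸) ∈ 𝓝 (1 : 𝔸) := by
  have h := hasStrictFDerivAt_exp_zero (𝕂 := ℂ) (𝔸 := 𝔸)
  have h2 := HasStrictFDerivAt.map_nhds_eq_of_equiv
    (f' := ContinuousLinearEquiv.refl ℂ 𝔸) (f := NormedSpace.exp) (a := 0) h
  rw [NormedSpace.exp_zero] at h2
  rw [← h2]
  exact Filter.range_mem_map

/-- In a commutative Banach algebra, an invertible `1 + x` such that `1 + z x` is not invertible
for at most countably many `z` is an exponential. -/
theorem one_add_mem_range_exp {R : Type*} [NormedRing R] [NormedAlgebra ℂ R] [CompleteSpace R]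
    (hc : ∀ a b : R, Commute a b) (x : R) (hx : IsUnit (1 + x))
    (hcount : {z : ℂ | ¬ IsUnit (1 + z • x)}.Countable) :
    1 + x ∈ Set.range (NormedSpace.exp : R → R) := by
  set U : Set ℂ := {z | ¬ IsUnit (1 + z • x)}ᶜ with hU
  set S : Set ℂ := {z | 1 + z • x ∈ Set.range (NormedSpace.exp : R → R)} with hS
  have hexp : ∀ a b : R, NormedSpace.exp (a + b) = NormedSpace.exp a * NormedSpace.exp b := by
    intro a b
    let _ : NormedAlgebra ℚ R := NormedAlgebra.restrictScalars ℚ ℂ R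
    exact NormedSpace.exp_add_of_commute (hc a b)
  -- The plane minus a countable set is connected, so `0` and `1` can be joined through invertible
  -- `1 + z • x`.
  have hconn : IsPreconnected U :=
    (hcount.isConnected_compl_of_one_lt_rank (by simp [Complex.rank_real_complex])).isPreconnected
  -- Having a logarithm is locally constant on `U`: the quotient of nearby values is close to `1`,
  -- hence an exponential, and exponentials multiply since the algebra is commutative.
  have key : ∀ z₀ ∈ U, ∀ᶠ z in 𝓝 z₀, (z ∈ S ↔ z₀ ∈ S) := by
    intro z₀ hz₀
    have hz₀' : IsUnit (1 + z₀ • x) := by simpa [hU] using hz₀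
    obtain ⟨u, hu⟩ := hz₀'
    have hcont : Filter.Tendsto (fun z : ℂ => 1 + (z - z₀) • (↑u⁻¹ * x)) (𝓝 z₀) (𝓝 1) := by
      have : Continuous (fun z : ℂ => 1 + (z - z₀) • (↑u⁻¹ * x)) := by fun_prop
      simpa using this.tendsto z₀
    filter_upwards [hcont range_exp_mem_nhds_one] with z hz
    obtain ⟨L, hL⟩ := hz
    have hfac : 1 + z • x = (1 + z₀ • x) * NormedSpace.exp L := by
      rw [hL, ← hu, mul_add, mul_one, mul_smul_comm, ← mul_assoc, Units.mul_inv, one_mul, hu]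
      module
    constructor
    · rintro ⟨K, hK⟩
      refine ⟨K - L, ?_⟩
      have h1 : NormedSpace.exp L * NormedSpace.exp (-L) = 1 := by
        rw [← hexp, add_neg_cancel, NormedSpace.exp_zero]
      rw [sub_eq_add_neg, hexp, hK]
      rw [hfac, mul_assoc, h1, mul_one]
    · rintro ⟨K, hK⟩
      exact ⟨K + L, by rw [hexp, hK, hfac]⟩
  have h0U : (0 : ℂ) ∈ U := by simp [hU]
  have h1U : (1 : ℂ) ∈ U := by simpa [hU] using hx
  have h0S : (0 : ℂ) ∈ S := ⟨0, by simp⟩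
  let A : Set ℂ := interior S
  let B : Set ℂ := interior Sᶜ
  have hUAB : U ⊆ A ∪ B := by
    intro z hz
    by_cases hzS : z ∈ S
    · left
      exact mem_interior_iff_mem_nhds.2 ((key z hz).mono fun w hw => hw.2 hzS)
    · right
      exact mem_interior_iff_mem_nhds.2 ((key z hz).mono fun w hw hwS => hzS (hw.1 hwS))
  have hdisj : Disjoint A B :=
    Set.disjoint_of_subset interior_subset interior_subset disjoint_compl_right
  have h0A : (0 : ℂ) ∈ A := by
    rcases hUAB h0U with h | h
    · exact h
    · exact absurd h0S (interior_subset h)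
  have := hconn.subset_left_of_subset_union isOpen_interior isOpen_interior hdisj hUAB ⟨0, h0U, h0A⟩
  have h1 := interior_subset (this h1U)
  simpa [hS] using h1

/-- An invertible element of a Banach algebra with countable spectrum has a logarithm in its
bicommutant. -/
theorem exists_exp_eq_of_isUnit {𝔸 : Type*} [NormedRing 𝔸] [NormedAlgebra ℂ 𝔸] [CompleteSpace 𝔸]
    (a : 𝔸) (ha : IsUnit a) (hs : (spectrum ℂ a).Countable) :
    ∃ L : 𝔸, NormedSpace.exp L = a ∧ ∀ b, Commute a b → Commute L b := by
  -- The bicommutant of `a` is closed, commutative and stable under inverses, so the commutative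
  -- case applies inside it, and the logarithm it yields commutes with the commutant of `a`.
  let R : Subalgebra ℂ 𝔸 := Subalgebra.centralizer ℂ (Set.centralizer {a})
  have hmem : ∀ x : 𝔸, x ∈ R ↔ ∀ b, Commute a b → Commute b x := by
    intro x
    simp only [R, Subalgebra.mem_centralizer_iff, Set.mem_centralizer_iff, Set.mem_singleton_iff,
      forall_eq]
    rfl
  have haR : a ∈ R := (hmem a).2 fun b hb => hb.symm
  have hclosed : IsClosed (R : Set 𝔸) := by
    have : (R : Set 𝔸) = Set.centralizer (Set.centralizer {a}) := rfl
    rw [this]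
    exact Set.isClosed_centralizer _
  have : CompleteSpace R := hclosed.completeSpace_coe
  have hcomm : ∀ x y : R, Commute x y := by
    intro x y
    have hx := (hmem x).1 x.2
    have hy := (hmem y).1 y.2
    exact Subtype.ext (hy x (hx a (Commute.refl a)))
  have hinv : ∀ x : R, IsUnit (x : 𝔸) → IsUnit x := by
    rintro x ⟨u, hu⟩
    have hmemi : (↑u⁻¹ : 𝔸) ∈ R := (hmem _).2 fun b hb => by
      have : Commute b u := by rw [hu]; exact (hmem x).1 x.2 b hb
      exact this.units_inv_right
    exact ⟨⟨x, ⟨_, hmemi⟩, Subtype.ext (by simp [← hu]), Subtype.ext (by simp [← hu])⟩, rfl⟩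
  have hcoe : ∀ z : ℂ, ((1 + z • (⟨a, haR⟩ - 1 : R) : R) : 𝔸) = 1 + z • (a - 1) := fun z => by simp
  have hcount : {z : ℂ | ¬ IsUnit (1 + z • (⟨a, haR⟩ - 1 : R))}.Countable := by
    refine (hs.image fun w => (1 - w)⁻¹).mono ?_
    intro z hz
    have hz0 : z ≠ 0 := by rintro rfl; simp at hz
    -- `1 + z(a - 1) = -z((1 - z⁻¹) - a)`, so the bad parameters correspond to spectral values of
    -- `a`.
    refine ⟨1 - z⁻¹, ?_, by simp⟩
    intro hres
    apply hz
    apply hinv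
    rw [hcoe]
    have h1 : (1 + z • (a - 1) : 𝔸) = (-z) • (algebraMap ℂ 𝔸 (1 - z⁻¹) - a) := by
      rw [Algebra.algebraMap_eq_smul_one, sub_smul, neg_smul, smul_sub, smul_sub, smul_sub,
        smul_smul z z⁻¹, mul_inv_cancel₀ hz0]
      module
    rw [h1]
    exact (IsUnit.smul (Units.mk0 (-z) (neg_ne_zero.2 hz0)) hres : _)
  obtain ⟨L, hL⟩ := one_add_mem_range_exp hcomm (⟨a, haR⟩ - 1 : R)
    (by rw [add_sub_cancel]; exact hinv _ ha) hcount
  refine ⟨L, ?_, fun b hb => ((hmem L).1 L.2 b hb).symm⟩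
  have h2 := congrArg (R.val) hL
  rw [add_sub_cancel] at h2
  have h3 : R.val (NormedSpace.exp L) = NormedSpace.exp (R.val L) :=
    NormedSpace.map_exp_of_mem_ball (𝕂 := ℂ) R.val continuous_subtype_val L
      (by simp [NormedSpace.expSeries_radius_eq_top])
  rw [h3] at h2
  exact h2

/-! ### Splitting off a Jordan block, and triangularization. -/

/-- Take the least exponent `m + 1` for which `ker n` is not contained in the range of `n ^ (m +
1)`. Some kernel vector is then `(n ^ m) v` but lies outside that range, and `φ` separates it from
the range. -/
theorem exists_chain {E : Type*} [AddCommGroup E] [Module ℂ E] [FiniteDimensional ℂ E]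
    (n : Module.End ℂ E) (hn : LinearMap.ker n ≠ ⊥) :
    ∃ (m : ℕ) (v : E) (φ : E →ₗ[ℂ] ℂ), (n ^ (m + 1)) v = 0 ∧ φ ((n ^ m) v) = 1 ∧
      ∀ x, φ ((n ^ (m + 1)) x) = 0 := by
  classical
  have hex : ∃ k, ¬ LinearMap.ker n ≤ LinearMap.range (n ^ k) := by
    obtain ⟨k, hk⟩ := (n.eventually_disjoint_ker_pow_range_pow.and
      (Filter.eventually_ge_atTop 1)).exists
    refine ⟨k, fun hle => hn ?_⟩
    rw [eq_bot_iff]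
    have h1 : LinearMap.ker n ≤ LinearMap.ker (n ^ k) := by
      intro x hx
      obtain ⟨j, rfl⟩ : ∃ j, k = j + 1 := ⟨k - 1, by omega⟩
      rw [LinearMap.mem_ker] at hx ⊢
      rw [pow_succ, Module.End.mul_apply, hx, map_zero]
    exact hk.1 h1 hle
  have hspec := Nat.find_spec hex
  have hmin := fun {k} => Nat.find_min hex (m := k)
  obtain ⟨m, hm⟩ : ∃ m, Nat.find hex = m + 1 := by
    refine Nat.exists_eq_succ_of_ne_zero fun h0 => ?_
    rw [h0] at hspec
    simp [Module.End.one_eq_id] at hspec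
  rw [hm] at hspec
  have hle : LinearMap.ker n ≤ LinearMap.range (n ^ m) := not_not.1 (hmin (by omega))
  obtain ⟨w, hw, hwr⟩ := Set.not_subset.1 hspec
  obtain ⟨v, rfl⟩ := hle hw
  obtain ⟨φ, hφ, hφ'⟩ := Submodule.exists_le_ker_of_notMem hwr
  refine ⟨m, v, (φ ((n ^ m) v))⁻¹ • φ, ?_, ?_, ?_⟩
  · rw [pow_succ', Module.End.mul_apply]; exact hw
  · simp [hφ]
  · intro x
    have : φ ((n ^ (m + 1)) x) = 0 := hφ' ⟨x, rfl⟩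
    simp [this]

/-- The chain `v, n v, …, n^m v` spans the Jordan block. The common kernel of the functionals `φ ∘
n^i`, `i ≤ m`, is invariant because `φ ∘ n^(m+1) = 0`. It is a complement because pairing these
functionals with the chain gives a unitriangular matrix. -/
theorem exists_basis_toMatrix_eq_fromBlocks {E : Type*} [AddCommGroup E] [Module ℂ E]
    [FiniteDimensional ℂ E] (f : Module.End ℂ E) (α : ℂ)
    (hα : LinearMap.ker (f - α • LinearMap.id) ≠ ⊥) :
    ∃ (s t : ℕ) (b : Module.Basis (Fin s ⊕ Fin t) ℂ E) (T : Matrix (Fin t) (Fin t) ℂ), 1 ≤ s ∧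
      LinearMap.toMatrix b b f = Matrix.fromBlocks (jordanBlock s α) 0 0 T := by
  classical
  set n : Module.End ℂ E := f - α • LinearMap.id with hn
  have hf : ∀ x, f x = α • x + n x := fun x => by simp [hn]
  obtain ⟨m, v, φ, hv, hφv, hφ⟩ := exists_chain n hα
  have hv' : ∀ k, m < k → (n ^ k) v = 0 := by
    intro k hk
    obtain ⟨j, rfl⟩ := Nat.exists_eq_add_of_lt hk
    rw [show m + j + 1 = j + (m + 1) by omega, pow_add, Module.End.mul_apply, hv, map_zero]
  -- The chain is listed in reverse, so that the ones fall on the superdiagonal and the pairing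
  -- matrix `A` is upper triangular.
  let c : Fin (m + 1) → E := fun i => (n ^ (m - (i : ℕ))) v
  let Ψ : E →ₗ[ℂ] (Fin (m + 1) → ℂ) := LinearMap.pi fun i => φ ∘ₗ (n ^ (i : ℕ))
  let B : (Fin (m + 1) → ℂ) →ₗ[ℂ] E := Fintype.linearCombination ℂ c
  have hΨc : ∀ i k : Fin (m + 1), Ψ (c k) i = φ ((n ^ ((i : ℕ) + (m - k))) v) := by
    intro i k
    simp [Ψ, c, pow_add, Module.End.mul_apply]
  let A : Matrix (Fin (m + 1)) (Fin (m + 1)) ℂ := Matrix.of fun i k => Ψ (c k) i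
  have hAtri : A.IsUpperTriangular := by
    intro i k hik
    have hik' : (k : ℕ) < i := hik
    change Ψ (c k) i = 0
    rw [hΨc, hv' _ (by omega), map_zero]
  have hAdet : A.det = 1 := by
    rw [Matrix.det_of_isUpperTriangular hAtri]
    refine Finset.prod_eq_one fun i _ => ?_
    change Ψ (c i) i = 1
    rw [hΨc, show (i : ℕ) + (m - i) = m by omega, hφv]
  have hAB : ∀ a, Ψ (B a) = A.mulVec a := by
    intro a
    ext i
    simp only [B, Fintype.linearCombination_apply, map_sum, map_smul, Finset.sum_apply,
      Pi.smul_apply, smul_eq_mul, Matrix.mulVec, dotProduct, A, Matrix.of_apply]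
    exact Finset.sum_congr rfl fun _ _ => mul_comm _ _
  have hAu : IsUnit A.det := by simp [hAdet]
  have hBinj : Function.Injective B := by
    intro a a' h
    have h2 : A.mulVec a = A.mulVec a' := by rw [← hAB, ← hAB, h]
    exact Matrix.mulVec_injective_of_isUnit ((Matrix.isUnit_iff_isUnit_det A).2 hAu) h2
  have hcompl : IsCompl (LinearMap.range B) (LinearMap.ker Ψ) := by
    constructor
    · rw [Submodule.disjoint_def]
      rintro _ ⟨a, rfl⟩ h
      rw [LinearMap.mem_ker, hAB] at h
      have : a = 0 := Matrix.mulVec_injective_of_isUnit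
        ((Matrix.isUnit_iff_isUnit_det A).2 hAu) (by rw [h, Matrix.mulVec_zero])
      rw [this, map_zero]
    · rw [codisjoint_iff, eq_top_iff]
      intro x _
      refine Submodule.mem_sup.2 ⟨B (A⁻¹.mulVec (Ψ x)), ⟨_, rfl⟩, x - B (A⁻¹.mulVec (Ψ x)), ?_,
        by abel⟩
      rw [LinearMap.mem_ker, map_sub, hAB, Matrix.mulVec_mulVec, Matrix.mul_nonsing_inv _ hAu,
        Matrix.one_mulVec, sub_self]
  have hKinv : ∀ x ∈ LinearMap.ker Ψ, f x ∈ LinearMap.ker Ψ := by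
    intro x hx
    rw [LinearMap.mem_ker] at hx ⊢
    rw [hf, map_add, map_smul, hx, smul_zero, zero_add]
    ext i
    have h1 : Ψ (n x) i = φ ((n ^ ((i : ℕ) + 1)) x) := by
      simp [Ψ, pow_succ, Module.End.mul_apply]
    rw [h1]
    by_cases hi : (i : ℕ) = m
    · rw [hi]; exact hφ x
    · have := congrFun hx ⟨i + 1, by omega⟩
      simpa [Ψ] using this
  let b₁ : Module.Basis (Fin (m + 1)) ℂ (LinearMap.range B) :=
    (Pi.basisFun ℂ (Fin (m + 1))).map (LinearEquiv.ofInjective B hBinj)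
  let b₂ := Module.finBasis ℂ (LinearMap.ker Ψ)
  let eq := Submodule.prodEquivOfIsCompl _ _ hcompl
  let b := (b₁.prod b₂).map eq
  have hb₁ : ∀ i, b (Sum.inl i) = c i := by
    intro i
    simp [b, eq, b₁, B, Fintype.linearCombination_apply_single]
  have hb₂ : ∀ j, b (Sum.inr j) = (b₂ j : E) := by
    intro j
    simp [b, eq]
  have hrepr : ∀ x ∈ LinearMap.ker Ψ, ∀ i, b.repr x (Sum.inl i) = 0 := by
    intro x hx i
    have h1 : eq.symm x = (0, ⟨x, hx⟩) :=
      Submodule.prodEquivOfIsCompl_symm_apply_right _ _ hcompl ⟨x, hx⟩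
    change (b₁.prod b₂).repr (eq.symm x) (Sum.inl i) = 0
    rw [h1, Module.Basis.prod_repr_inl, map_zero, Finsupp.zero_apply]
  have hnc : ∀ k : Fin (m + 1), n (c k) = if h : (k : ℕ) = 0 then 0 else c ⟨k - 1, by omega⟩ := by
    intro k
    have h1 : n (c k) = (n ^ (m - (k : ℕ) + 1)) v := by
      rw [pow_succ', Module.End.mul_apply]
    rw [h1]
    split_ifs with h
    · exact hv' _ (by omega)
    · change _ = (n ^ (m - ((k : ℕ) - 1))) v
      rw [show m - ((k : ℕ) - 1) = m - (k : ℕ) + 1 by omega]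
  refine ⟨m + 1, _, b, LinearMap.toMatrix b₂ b₂ (f.restrict hKinv), by omega, ?_⟩
  ext i k
  rw [LinearMap.toMatrix_apply]
  rcases k with k | k
  · have h1 : f (b (Sum.inl k)) = α • b (Sum.inl k) +
        if h : (k : ℕ) = 0 then 0 else b (Sum.inl ⟨k - 1, by omega⟩) := by
      simp only [hb₁]
      rw [hf, hnc]
    rw [h1, map_add, map_smul, Module.Basis.repr_self]
    by_cases hk : (k : ℕ) = 0
    · rw [dif_pos hk, map_zero]
      rcases i with i | i
      · have h2 : ¬ (i : ℕ) + 1 = k := by omega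
        simp [jordanBlock, h2, Finsupp.single_apply, @eq_comm _ k i]
      · simp
    · rw [dif_neg hk, Module.Basis.repr_self]
      rcases i with i | i
      · by_cases hik : i = k
        · subst hik
          have h3 : (⟨(i : ℕ) - 1, by omega⟩ : Fin (m + 1)) ≠ i := by
            intro h; have := congrArg Fin.val h; simp only at this; omega
          simp [jordanBlock, h3]
        · have h3 : ((⟨(k : ℕ) - 1, by omega⟩ : Fin (m + 1)) = i) ↔ (i : ℕ) + 1 = k := by
            rw [Fin.ext_iff]; simp only; omega
          simp [jordanBlock, Finsupp.single_apply, h3, hik]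
      · simp
  · rw [hb₂]
    rcases i with i | i
    · rw [hrepr _ (hKinv _ (b₂ k).2)]
      simp
    · have h1 : eq.symm (f (b₂ k : E)) = (0, ⟨f (b₂ k), hKinv _ (b₂ k).2⟩) :=
        Submodule.prodEquivOfIsCompl_symm_apply_right _ _ hcompl ⟨f (b₂ k), hKinv _ (b₂ k).2⟩
      change (b₁.prod b₂).repr (eq.symm (f (b₂ k : E))) (Sum.inr i) = _
      rw [h1, Module.Basis.prod_repr_inr, Matrix.fromBlocks_apply₂₂, LinearMap.toMatrix_apply]
      rfl

/-- The index bijection between blocks of sizes `s`, `t` and `Fin r` for `s + t = r`. -/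
def blockEquiv {s t r : ℕ} (h : s + t = r) : Fin s ⊕ Fin t ≃ Fin r :=
  finSumFinEquiv.trans (finCongr h)

/-- A square matrix with eigenvalue `α` is similar to the direct sum of a Jordan block with
eigenvalue `α` and a further matrix. -/
theorem exists_jordanBlock_summand {r : ℕ} (T : Matrix (Fin r) (Fin r) ℂ) (α : ℂ)
    (hα : (T - α • (1 : Matrix (Fin r) (Fin r) ℂ)).det = 0) :
    ∃ (s t : ℕ) (h : s + t = r) (P : GL (Fin r) ℂ) (T' : Matrix (Fin t) (Fin t) ℂ), 1 ≤ s ∧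
      P.val * T = Matrix.reindex (blockEquiv h) (blockEquiv h)
        (Matrix.fromBlocks (jordanBlock s α) 0 0 T') * P.val := by
  have hker : LinearMap.ker (Matrix.toLin' T - α • LinearMap.id) ≠ ⊥ := by
    rw [← Matrix.exists_mulVec_eq_zero_iff] at hα
    obtain ⟨v, hv, h0⟩ := hα
    refine (Submodule.ne_bot_iff _).2 ⟨v, ?_, hv⟩
    simpa [Matrix.sub_mulVec, Matrix.smul_mulVec] using h0
  obtain ⟨s, t, b, T', hs, hb⟩ := exists_basis_toMatrix_eq_fromBlocks _ _ hker
  have h : s + t = r := by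
    have h1 := Module.finrank_eq_card_basis b
    simpa using h1.symm
  let b' := b.reindex (blockEquiv h)
  let std := Pi.basisFun ℂ (Fin r)
  refine ⟨s, t, h, ⟨b'.toMatrix std, std.toMatrix b', Module.Basis.toMatrix_mul_toMatrix_flip _ _,
    Module.Basis.toMatrix_mul_toMatrix_flip _ _⟩, T', hs, ?_⟩
  have h1 : T = LinearMap.toMatrix std std (Matrix.toLin' T) := by
    simp [std, LinearMap.toMatrix_eq_toMatrix']
  have h2 : Matrix.reindex (blockEquiv h) (blockEquiv h)
      (Matrix.fromBlocks (jordanBlock s α) 0 0 T') =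
      LinearMap.toMatrix b' b' (Matrix.toLin' T) := by
    rw [← hb]
    ext i j
    simp [b', LinearMap.toMatrix_apply]
  rw [h2]
  change b'.toMatrix std * T = _ * b'.toMatrix std
  conv_lhs => rw [h1]
  rw [basis_toMatrix_mul_linearMap_toMatrix, linearMap_toMatrix_mul_basis_toMatrix]

theorem isUpperTriangular_reindex_fromBlocks {s t r : ℕ} (h : s + t = r)
    {A : Matrix (Fin s) (Fin s) ℂ} {B : Matrix (Fin t) (Fin t) ℂ}
    (hA : A.IsUpperTriangular) (hB : B.IsUpperTriangular) :
    (Matrix.reindex (blockEquiv h) (blockEquiv h)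
      (Matrix.fromBlocks A 0 0 B)).IsUpperTriangular := by
  subst h
  intro i j hij
  replace hij : j < i := hij
  rw [Matrix.reindex_apply, Matrix.submatrix_apply]
  obtain ⟨i, rfl⟩ := (blockEquiv rfl).surjective i
  obtain ⟨j, rfl⟩ := (blockEquiv rfl).surjective j
  rw [Equiv.symm_apply_apply, Equiv.symm_apply_apply]
  rcases i with i | i <;> rcases j with j | j
  · have hij' : Fin.castAdd t j < Fin.castAdd t i := by simpa [blockEquiv] using hij
    exact hA hij'
  · rfl
  · rfl
  · exact hB (show j < i by simpa [blockEquiv] using hij)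

theorem isUpperTriangular_jordanBlock (s : ℕ) (α : ℂ) : (jordanBlock s α).IsUpperTriangular := by
  intro i j hij
  have h : (j : ℕ) < i := hij
  have h1 : i ≠ j := by rintro rfl; exact lt_irrefl _ h
  have h2 : (i : ℕ) + 1 ≠ j := by omega
  simp [jordanBlock, h1, h2]

/-- Every complex square matrix is similar to an upper triangular one. -/
theorem exists_conj_isUpperTriangular (r : ℕ) : ∀ T : Matrix (Fin r) (Fin r) ℂ,
    ∃ (P : GL (Fin r) ℂ) (U : Matrix (Fin r) (Fin r) ℂ), U.IsUpperTriangular ∧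
      P.val * T = U * P.val := by
  induction r using Nat.strong_induction_on with
  | _ r ih =>
    intro T
    rcases Nat.eq_zero_or_pos r with rfl | hr
    · exact ⟨1, T, fun i => i.elim0, by simp⟩
    · have : Nonempty (Fin r) := ⟨⟨0, hr⟩⟩
      have : Nontrivial (Fin r → ℂ) := inferInstance
      obtain ⟨α, hα⟩ := Module.End.exists_eigenvalue (Matrix.toLin' T)
      obtain ⟨v, hv⟩ := hα.exists_hasEigenvector
      have hdet : (T - α • (1 : Matrix (Fin r) (Fin r) ℂ)).det = 0 := by
        rw [← Matrix.exists_mulVec_eq_zero_iff]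
        refine ⟨v, hv.2, ?_⟩
        have := hv.apply_eq_smul
        rw [Matrix.toLin'_apply] at this
        rw [Matrix.sub_mulVec, this, Matrix.smul_mulVec, Matrix.one_mulVec, sub_self]
      obtain ⟨s, t, h, P, T', hs, hP⟩ := exists_jordanBlock_summand T α hdet
      obtain ⟨Q, U, hU, hQ⟩ := ih t (by omega) T'
      let e := blockEquiv h
      let R : GL (Fin r) ℂ := Units.map (Matrix.reindexAlgEquiv ℂ ℂ e).toMonoidHom
        (blockDiagGL (1 : GL (Fin s) ℂ) Q)
      have hR : R.val = Matrix.reindexAlgEquiv ℂ ℂ e (Matrix.fromBlocks 1 0 0 Q.val) := rfl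
      refine ⟨R * P, _, isUpperTriangular_reindex_fromBlocks h
        (isUpperTriangular_jordanBlock s α) hU, ?_⟩
      rw [Units.val_mul, mul_assoc, hP, ← mul_assoc, ← mul_assoc]
      congr 1
      rw [hR, ← Matrix.coe_reindexAlgEquiv ℂ ℂ, ← map_mul, ← map_mul, Matrix.fromBlocks_multiply,
        Matrix.fromBlocks_multiply]
      simp [hQ, e]

/-! ### The `q`-Pochhammer symbol and theta functions with values in a Banach algebra. -/

/-- Taylor coefficients of the `q`-Pochhammer symbol `y ↦ ∏ (1 - q ^ n y)`. -/
def qPochCoeff (q : ℂ) : ℕ → ℂ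
  | 0 => 1
  | n + 1 => -q ^ n / (1 - q ^ (n + 1)) * qPochCoeff q n

theorem summable_qPochCoeff {q : ℂ} (hq : ‖q‖ < 1) (R : ℝ) :
    Summable fun n => ‖qPochCoeff q n‖ * R ^ n := by
  have hlim : Filter.Tendsto (fun n : ℕ => ‖-q ^ n / (1 - q ^ (n + 1))‖ * |R|) Filter.atTop
      (𝓝 0) := by
    have h1 : Filter.Tendsto (fun n : ℕ => q ^ n) Filter.atTop (𝓝 0) :=
      tendsto_pow_atTop_nhds_zero_of_norm_lt_one hq
    have h2 := h1.comp (Filter.tendsto_add_atTop_nat 1)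
    have h3 := ((h1.neg.div (h2.const_sub 1) (by simp)).norm).mul_const |R|
    simpa using h3
  refine summable_of_ratio_norm_eventually_le (r := 1 / 2) (by norm_num) ?_
  filter_upwards [hlim.eventually_lt_const (show (0 : ℝ) < 1 / 2 by norm_num)] with n hn
  have : ‖‖qPochCoeff q (n + 1)‖ * R ^ (n + 1)‖ =
      (‖-q ^ n / (1 - q ^ (n + 1))‖ * |R|) * ‖‖qPochCoeff q n‖ * R ^ n‖ := by
    rw [qPochCoeff]
    simp only [norm_mul, norm_norm, norm_pow (_ : ℝ), Real.norm_eq_abs R, pow_succ |R|]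
    ring
  rw [this]
  exact mul_le_mul_of_nonneg_right hn.le (norm_nonneg _)

section BanachAlgebra

variable {𝔸 : Type*} [NormedRing 𝔸] [NormedAlgebra ℂ 𝔸]

/-- The `q`-Pochhammer symbol `∏ (1 - q ^ n Y)` of an element of a Banach algebra. -/
def qPoch (q : ℂ) (Y : 𝔸) : 𝔸 := ∑' n, qPochCoeff q n • Y ^ n

/-- The factor `1 + ‖1‖` only serves the term `n = 0`, since the norm of the unit need not be `1`.
-/
theorem norm_qPoch_term_le (q : ℂ) {Y : 𝔸} {R : ℝ} (hY : ‖Y‖ ≤ R) (n : ℕ) :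
    ‖qPochCoeff q n • Y ^ n‖ ≤ (1 + ‖(1 : 𝔸)‖) * (‖qPochCoeff q n‖ * R ^ n) := by
  have h1 : ‖Y ^ n‖ ≤ (1 + ‖(1 : 𝔸)‖) * R ^ n := by
    rcases Nat.eq_zero_or_pos n with rfl | hn
    · simp
    · have h2 : ‖Y ^ n‖ ≤ R ^ n := (norm_pow_le' Y hn).trans
        (pow_le_pow_left₀ (norm_nonneg _) hY n)
      have h3 : 0 ≤ R ^ n := (norm_nonneg _).trans h2
      nlinarith [norm_nonneg (1 : 𝔸)]
  calc ‖qPochCoeff q n • Y ^ n‖ = ‖qPochCoeff q n‖ * ‖Y ^ n‖ := norm_smul _ _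
    _ ≤ ‖qPochCoeff q n‖ * ((1 + ‖(1 : 𝔸)‖) * R ^ n) := by gcongr
    _ = _ := by ring

theorem summable_qPoch [CompleteSpace 𝔸] {q : ℂ} (hq : ‖q‖ < 1) (Y : 𝔸) :
    Summable fun n => qPochCoeff q n • Y ^ n :=
  ((summable_qPochCoeff hq ‖Y‖).mul_left _).of_norm_bounded (norm_qPoch_term_le q le_rfl)

theorem differentiable_qPoch_smul [CompleteSpace 𝔸] {q : ℂ} (hq : ‖q‖ < 1) (Y : 𝔸) :
    Differentiable ℂ fun x : ℂ => qPoch q (x • Y) := by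
  intro x
  have hx : x ∈ Metric.ball (0 : ℂ) (‖x‖ + 1) := by simp
  refine DifferentiableOn.differentiableAt (s := Metric.ball (0 : ℂ) (‖x‖ + 1)) ?_
    (Metric.isOpen_ball.mem_nhds hx)
  refine Complex.differentiableOn_tsum_of_summable_norm
    ((summable_qPochCoeff hq ((‖x‖ + 1) * ‖Y‖)).mul_left (1 + ‖(1 : 𝔸)‖)) (fun n => ?_)
    Metric.isOpen_ball fun n w hw => ?_
  · have : (fun w : ℂ => qPochCoeff q n • (w • Y) ^ n) =
        fun w : ℂ => qPochCoeff q n • (w ^ n • Y ^ n) := by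
      ext w; rw [smul_pow]
    rw [this]
    have h1 : Differentiable ℂ fun w : ℂ => w ^ n := differentiable_id.fun_pow n
    exact ((h1.smul_const (Y ^ n)).const_smul (qPochCoeff q n)).differentiableOn
  · refine norm_qPoch_term_le q ?_ n
    rw [norm_smul]
    have : ‖w‖ < ‖x‖ + 1 := by simpa using hw
    gcongr

theorem commute_qPoch {q : ℂ} {X Y : 𝔸} (h : Commute X Y) : Commute X (qPoch q Y) :=
  Commute.tsum_right X fun _ => (h.pow_right _).smul_right _

theorem qPoch_zero (q : ℂ) : qPoch q (0 : 𝔸) = 1 := by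
  rw [qPoch, tsum_eq_single 0 fun n hn => by rw [zero_pow hn, smul_zero]]
  simp [qPochCoeff]

/-- Comparison of coefficients: the recursion says `c_{n+1} = q^{n+1} c_{n+1} - q^n c_n`. This
functional equation stands in for the infinite product. -/
theorem qPoch_eq_one_sub_mul [CompleteSpace 𝔸] {q : ℂ} (hq : ‖q‖ < 1) (Y : 𝔸) :
    qPoch q Y = (1 - Y) * qPoch q (q • Y) := by
  have h1 := summable_qPoch hq (q • Y)
  have h2 := summable_qPoch hq Y
  have hne : ∀ n : ℕ, 1 - q ^ (n + 1) ≠ 0 := by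
    intro n h
    have h3 : ‖q ^ (n + 1)‖ < 1 := by
      rw [norm_pow]; exact pow_lt_one₀ (norm_nonneg _) hq (by omega)
    rw [← sub_eq_zero.1 h, norm_one] at h3
    exact lt_irrefl _ h3
  rw [sub_mul, one_mul, qPoch, qPoch, ← h1.tsum_mul_left, h2.tsum_eq_zero_add,
    h1.tsum_eq_zero_add, add_sub_assoc, ← Summable.tsum_sub ((summable_nat_add_iff 1).2 h1)
      (h1.mul_left Y)]
  congr 1
  · simp
  · refine tsum_congr fun n => ?_
    rw [smul_pow, smul_pow, mul_smul_comm, mul_smul_comm, ← pow_succ', smul_smul, smul_smul,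
      ← sub_smul]
    congr 1
    rw [qPochCoeff]
    field_simp [hne n]
    ring

/-- The theta function with values in a Banach algebra attached to a unit `W`. -/
def thetaAlg (τ : UpperHalfPlane) (W : 𝔸ˣ) (u : ℂ) : 𝔸 :=
  qPoch (Complex.exp (2 * Real.pi * Complex.I * τ))
      (Complex.exp (2 * Real.pi * Complex.I * u) • (W : 𝔸)) *
    qPoch (Complex.exp (2 * Real.pi * Complex.I * τ))
      (Complex.exp (2 * Real.pi * Complex.I * (τ - u)) • (↑W⁻¹ : 𝔸))

theorem norm_nome_lt_one (τ : UpperHalfPlane) :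
    ‖Complex.exp (2 * Real.pi * Complex.I * τ)‖ < 1 := by
  rw [Complex.norm_exp, Real.exp_lt_one_iff]
  have : (2 * (Real.pi : ℂ) * Complex.I * τ).re = -(2 * Real.pi * τ.im) := by
    simp [Complex.mul_re, Complex.mul_im]
  rw [this]
  have := τ.im_pos
  have := Real.pi_pos
  simp only [Left.neg_neg_iff]
  positivity

theorem differentiable_thetaAlg [CompleteSpace 𝔸] (τ : UpperHalfPlane) (W : 𝔸ˣ) :
    Differentiable ℂ (thetaAlg τ W) := by
  have h1 := differentiable_qPoch_smul (norm_nome_lt_one τ) (W : 𝔸)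
  have h2 := differentiable_qPoch_smul (norm_nome_lt_one τ) (↑W⁻¹ : 𝔸)
  have h3 : Differentiable ℂ fun u : ℂ => Complex.exp (2 * Real.pi * Complex.I * u) := by fun_prop
  have h4 : Differentiable ℂ fun u : ℂ => Complex.exp (2 * Real.pi * Complex.I * (τ - u)) := by
    fun_prop
  exact (h1.comp h3).mul (h2.comp h4)

theorem thetaAlg_add_one (τ : UpperHalfPlane) (W : 𝔸ˣ) (u : ℂ) :
    thetaAlg τ W (u + 1) = thetaAlg τ W u := by
  have h1 : Complex.exp (2 * Real.pi * Complex.I * (u + 1)) =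
      Complex.exp (2 * Real.pi * Complex.I * u) := by
    rw [mul_add, mul_one, Complex.exp_periodic]
  have h2 : Complex.exp (2 * Real.pi * Complex.I * (τ - (u + 1))) =
      Complex.exp (2 * Real.pi * Complex.I * (τ - u)) := by
    rw [← Complex.exp_periodic (2 * Real.pi * Complex.I * (τ - (u + 1)))]
    congr 1
    ring
  rw [thetaAlg, thetaAlg, h1, h2]

/-- With `x = exp(2πiu)`, the shift by `τ` removes the factor `1 - xW` from the first product and
adds `1 - x⁻¹W⁻¹ = -x⁻¹W⁻¹(1 - xW)` to the second. -/
theorem thetaAlg_add_tau [CompleteSpace 𝔸] (τ : UpperHalfPlane) (W : 𝔸ˣ) (u : ℂ) :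
    thetaAlg τ W (u + τ) =
      (-Complex.exp (-(2 * Real.pi * Complex.I * u))) • ((↑W⁻¹ : 𝔸) * thetaAlg τ W u) := by
  have hq := norm_nome_lt_one τ
  rw [thetaAlg, thetaAlg]
  set q := Complex.exp (2 * Real.pi * Complex.I * τ) with hqdef
  have h1 : Complex.exp (2 * Real.pi * Complex.I * (u + τ)) =
      q * Complex.exp (2 * Real.pi * Complex.I * u) := by
    rw [hqdef, ← Complex.exp_add]; congr 1; ring
  have h2 : Complex.exp (2 * Real.pi * Complex.I * (τ - (u + τ))) =
      Complex.exp (-(2 * Real.pi * Complex.I * u)) := by congr 1; ring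
  have h3 : Complex.exp (2 * Real.pi * Complex.I * (τ - u)) =
      q * Complex.exp (-(2 * Real.pi * Complex.I * u)) := by
    rw [hqdef, ← Complex.exp_add]; congr 1; ring
  rw [h1, h2, h3]
  set x := Complex.exp (2 * Real.pi * Complex.I * u) with hx
  have hxi : Complex.exp (-(2 * Real.pi * Complex.I * u)) = x⁻¹ := Complex.exp_neg _
  have hx0 : x ≠ 0 := Complex.exp_ne_zero _
  rw [hxi]
  rw [qPoch_eq_one_sub_mul hq (x • (W : 𝔸)), qPoch_eq_one_sub_mul hq (x⁻¹ • (↑W⁻¹ : 𝔸)),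
    smul_smul, smul_smul]
  have hc : Commute (1 - x⁻¹ • (↑W⁻¹ : 𝔸)) (qPoch q ((q * x) • (W : 𝔸))) := by
    refine commute_qPoch (Commute.smul_right ?_ _)
    refine (Commute.one_left _).sub_left (Commute.smul_left ?_ _)
    exact (Commute.refl (W : 𝔸)).units_inv_left
  rw [← mul_assoc, ← hc.eq]
  have hid : (1 - x⁻¹ • (↑W⁻¹ : 𝔸)) = (-x⁻¹) • ((↑W⁻¹ : 𝔸) * (1 - x • (W : 𝔸))) := by
    rw [mul_sub, mul_one, mul_smul_comm, Units.inv_mul, smul_sub, smul_smul, neg_mul,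
      inv_mul_cancel₀ hx0]
    module
  rw [hid]
  simp only [smul_mul_assoc, mul_assoc]

end BanachAlgebra

/-! ### The lattice and its fundamental domain. -/

theorem one_mem_lattice (τ : UpperHalfPlane) : (1 : ℂ) ∈ lattice τ := ⟨(1, 0), by simp⟩

theorem tau_mem_lattice (τ : UpperHalfPlane) : (τ : ℂ) ∈ lattice τ := ⟨(0, 1), by simp⟩

theorem intCast_mem_lattice (τ : UpperHalfPlane) (n : ℤ) : (n : ℂ) ∈ lattice τ := ⟨(n, 0), by simp⟩

theorem intCast_mul_tau_mem_lattice (τ : UpperHalfPlane) (n : ℤ) : (n * τ : ℂ) ∈ lattice τ :=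
  ⟨(0, n), by simp⟩

theorem lattice_induction {τ : UpperHalfPlane} {p : ℂ → Prop} (h1 : p 1) (hτ : p τ)
    (hadd : ∀ a ∈ lattice τ, ∀ b ∈ lattice τ, p a → p b → p (a + b))
    (hneg : ∀ a ∈ lattice τ, p a → p (-a)) {l : ℂ} (hl : l ∈ lattice τ) : p l := by
  have h0 : p 0 := by
    have := hadd 1 (one_mem_lattice τ) (-1) (neg_mem (one_mem_lattice τ)) h1
      (hneg 1 (one_mem_lattice τ) h1)
    simpa using this
  let S : AddSubgroup ℂ :=
    { carrier := {a | a ∈ lattice τ ∧ p a}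
      zero_mem' := ⟨zero_mem _, h0⟩
      add_mem' := fun {a b} ha hb => ⟨add_mem ha.1 hb.1, hadd a ha.1 b hb.1 ha.2 hb.2⟩
      neg_mem' := fun {a} ha => ⟨neg_mem ha.1, hneg a ha.1 ha.2⟩ }
  have h1S : (1 : ℂ) ∈ S := ⟨one_mem_lattice τ, h1⟩
  have hτS : (τ : ℂ) ∈ S := ⟨tau_mem_lattice τ, hτ⟩
  obtain ⟨⟨m, n⟩, rfl⟩ := hl
  have := add_mem (zsmul_mem h1S m) (zsmul_mem hτS n)
  simpa using this.2

theorem exists_sub_mem_strip (τ : UpperHalfPlane) (u : ℂ) :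
    ∃ n : ℤ, 0 ≤ (u - n * τ).im ∧ (u - n * τ).im < τ.im := by
  refine ⟨⌊u.im / τ.im⌋, ?_, ?_⟩
  · have := Int.floor_le (u.im / τ.im)
    rw [le_div_iff₀ τ.im_pos] at this
    simpa using this
  · have := Int.lt_floor_add_one (u.im / τ.im)
    rw [div_lt_iff₀ τ.im_pos, add_mul, one_mul] at this
    simp
    linarith

/-- Every point is congruent to a point of the fundamental domain. -/
theorem exists_sub_mem_fundamentalDomain (τ : UpperHalfPlane) (u : ℂ) :
    ∃ v ∈ fundamentalDomain τ, u - v ∈ lattice τ := by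
  have hτ := τ.im_pos.ne'
  set t : ℝ := u.im / τ.im with ht
  set s : ℝ := u.re - t * τ.re with hs
  have hu : u = s + t * τ := by
    apply Complex.ext
    · simp [hs]
    · simp [ht, div_mul_cancel₀ _ hτ]
  refine ⟨(Int.fract s : ℝ) + (Int.fract t : ℝ) * τ, ⟨_, ⟨Int.fract_nonneg _, Int.fract_lt_one _⟩, _,
    ⟨Int.fract_nonneg _, Int.fract_lt_one _⟩, rfl⟩, (⌊s⌋, ⌊t⌋), ?_⟩
  conv_rhs => rw [hu]
  simp only [Int.fract]
  push_cast
  ring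

theorem eq_of_sub_mem_lattice {τ : UpperHalfPlane} {u v : ℂ} (hu : u ∈ fundamentalDomain τ)
    (hv : v ∈ fundamentalDomain τ) (h : u - v ∈ lattice τ) : u = v := by
  obtain ⟨s, hs, t, ht, rfl⟩ := hu
  obtain ⟨s', hs', t', ht', rfl⟩ := hv
  obtain ⟨⟨m, n⟩, hmn⟩ := h
  have him := congrArg Complex.im hmn
  have hre := congrArg Complex.re hmn
  simp at him hre
  have h1 : (n : ℝ) = t - t' := by
    have : ((n : ℝ) - (t - t')) * τ.im = 0 := by linear_combination him
    rcases mul_eq_zero.1 this with h | h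
    · linarith
    · exact absurd h τ.im_pos.ne'
  have hn : n = 0 := by
    have a1 : (n : ℝ) < 1 := by rw [h1]; linarith [ht.2, ht'.1]
    have a2 : (-1 : ℝ) < n := by rw [h1]; linarith [ht.1, ht'.2]
    have b1 : n < 1 := by exact_mod_cast a1
    have b2 : -1 < n := by exact_mod_cast a2
    omega
  rw [hn, Int.cast_zero] at h1
  have htt : t = t' := by linarith
  subst htt
  rw [hn] at hre
  have h2 : (m : ℝ) = s - s' := by push_cast at hre; linarith
  have hm : m = 0 := by
    have a1 : (m : ℝ) < 1 := by rw [h2]; linarith [hs.2, hs'.1]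
    have a2 : (-1 : ℝ) < m := by rw [h2]; linarith [hs.1, hs'.2]
    have b1 : m < 1 := by exact_mod_cast a1
    have b2 : -1 < m := by exact_mod_cast a2
    omega
  rw [hm, Int.cast_zero] at h2
  rw [show s = s' by linarith]

/-! ### The scalar theta function and its zeros. -/

/-- For `‖y‖ < 1` the functional equation propagates a zero at `y` to all `q^n y`, and these tend to
`0`, where the value is `1`. -/
theorem qPoch_ne_zero {q y : ℂ} (hq : ‖q‖ < 1) (hy : ‖y‖ < 1) : qPoch q y ≠ 0 := by
  intro h
  have hpow : ∀ n : ℕ, qPoch q (q ^ n * y) = 0 := by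
    intro n
    induction n with
    | zero => simpa using h
    | succ n ih =>
      rw [qPoch_eq_one_sub_mul hq] at ih
      rcases mul_eq_zero.1 ih with h1 | h1
      · exfalso
        have h2 : ‖q ^ n * y‖ < 1 := by
          rw [norm_mul, norm_pow]
          calc ‖q‖ ^ n * ‖y‖ ≤ 1 * ‖y‖ := by
                gcongr; exact pow_le_one₀ (norm_nonneg _) hq.le
            _ < 1 := by simpa using hy
        rw [← sub_eq_zero.1 h1, norm_one] at h2
        exact lt_irrefl _ h2
      · rw [smul_eq_mul, ← mul_assoc, ← pow_succ'] at h1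
        exact h1
  have hcont : Continuous fun x : ℂ => qPoch q x := by
    have := (differentiable_qPoch_smul hq (1 : ℂ)).continuous
    simpa using this
  have hlim : Filter.Tendsto (fun n : ℕ => qPoch q (q ^ n * y)) Filter.atTop (𝓝 (qPoch q 0)) := by
    have h1 := (tendsto_pow_atTop_nhds_zero_of_norm_lt_one hq).mul_const y
    rw [zero_mul] at h1
    exact (hcont.tendsto 0).comp h1
  simp only [hpow] at hlim
  rw [qPoch_zero] at hlim
  exact zero_ne_one (tendsto_nhds_unique tendsto_const_nhds hlim)

/-- The scalar theta function, with simple zeros exactly at the lattice points. -/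
def sigma (τ : UpperHalfPlane) (u : ℂ) : ℂ := thetaAlg τ (1 : ℂˣ) u

theorem thetaAlg_unit (τ : UpperHalfPlane) (w : ℂˣ) (c : ℂ)
    (hw : (w : ℂ) = Complex.exp (2 * Real.pi * Complex.I * c)) (u : ℂ) :
    thetaAlg τ w u = sigma τ (u + c) := by
  rw [sigma, thetaAlg, thetaAlg, Units.val_inv_eq_inv_val, hw, ← Complex.exp_neg]
  simp only [smul_eq_mul, inv_one, Units.val_one, mul_one, ← Complex.exp_add]
  ring_nf

theorem differentiable_sigma (τ : UpperHalfPlane) : Differentiable ℂ (sigma τ) :=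
  differentiable_thetaAlg τ 1

theorem sigma_add_one (τ : UpperHalfPlane) (u : ℂ) : sigma τ (u + 1) = sigma τ u :=
  thetaAlg_add_one τ 1 u

theorem sigma_add_tau (τ : UpperHalfPlane) (u : ℂ) :
    sigma τ (u + τ) = -Complex.exp (-(2 * Real.pi * Complex.I * u)) * sigma τ u := by
  have := thetaAlg_add_tau τ (1 : ℂˣ) u
  simpa [sigma] using this

theorem exists_sigma_add_lattice (τ : UpperHalfPlane) {l : ℂ} (hl : l ∈ lattice τ) :
    ∃ e : ℂ → ℂ, Differentiable ℂ e ∧ (∀ u, e u ≠ 0) ∧ ∀ u, sigma τ (u + l) = e u * sigma τ u := by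
  refine lattice_induction (p := fun l => ∃ e : ℂ → ℂ, Differentiable ℂ e ∧ (∀ u, e u ≠ 0) ∧
    ∀ u, sigma τ (u + l) = e u * sigma τ u) ?_ ?_ ?_ ?_ hl
  · exact ⟨fun _ => 1, by fun_prop, by simp, by simp [sigma_add_one]⟩
  · exact ⟨fun u => -Complex.exp (-(2 * Real.pi * Complex.I * u)), by fun_prop,
      fun u => neg_ne_zero.2 (Complex.exp_ne_zero _), sigma_add_tau τ⟩
  · rintro a - b - ⟨e, he, he0, hea⟩ ⟨f, hf, hf0, hfb⟩
    refine ⟨fun u => f (u + a) * e u, ?_, fun u => mul_ne_zero (hf0 _) (he0 _), fun u => ?_⟩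
    · exact (hf.comp (differentiable_id.add_const a)).mul he
    · rw [← add_assoc, hfb, hea, mul_assoc]
  · rintro a - ⟨e, he, he0, hea⟩
    refine ⟨fun u => (e (u - a))⁻¹, ?_, fun u => inv_ne_zero (he0 _), fun u => ?_⟩
    · exact (he.comp (differentiable_id.sub_const a)).inv fun u => he0 _
    · have := hea (u - a)
      rw [sub_add_cancel] at this
      rw [this, ← sub_eq_add_neg, inv_mul_cancel_left₀ (he0 _)]

theorem sigma_eq (τ : UpperHalfPlane) (u : ℂ) :
    sigma τ u = (1 - Complex.exp (2 * Real.pi * Complex.I * u)) *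
      (qPoch (Complex.exp (2 * Real.pi * Complex.I * τ))
        (Complex.exp (2 * Real.pi * Complex.I * τ) * Complex.exp (2 * Real.pi * Complex.I * u)) *
      qPoch (Complex.exp (2 * Real.pi * Complex.I * τ))
        (Complex.exp (2 * Real.pi * Complex.I * (τ - u)))) := by
  rw [sigma, thetaAlg, qPoch_eq_one_sub_mul (norm_nome_lt_one τ), mul_assoc]
  simp

theorem sigma_eq_zero_iff (τ : UpperHalfPlane) (u : ℂ) : sigma τ u = 0 ↔ u ∈ lattice τ := by
  constructor
  · intro h
    -- After translation to `0 ≤ Im < Im τ`, both `q`-Pochhammer factors of `sigma_eq` have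
    -- arguments inside the unit disc, so only `1 - exp(2πiu)` can vanish.
    obtain ⟨n, h0, h1⟩ := exists_sub_mem_strip τ u
    obtain ⟨e, -, he0, he⟩ := exists_sigma_add_lattice τ (intCast_mul_tau_mem_lattice τ n)
    have h2 := he (u - n * τ)
    rw [sub_add_cancel, h] at h2
    have h3 : sigma τ (u - n * τ) = 0 := (mul_eq_zero.1 h2.symm).resolve_left (he0 _)
    have hnorm : ∀ v : ℂ, 0 < v.im → ‖Complex.exp (2 * Real.pi * Complex.I * v)‖ < 1 := by
      intro v hv
      exact norm_nome_lt_one ⟨v, hv⟩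
    rw [sigma_eq] at h3
    have h4 : qPoch (Complex.exp (2 * Real.pi * Complex.I * τ))
        (Complex.exp (2 * Real.pi * Complex.I * τ) *
          Complex.exp (2 * Real.pi * Complex.I * (u - n * τ))) ≠ 0 := by
      refine qPoch_ne_zero (norm_nome_lt_one τ) ?_
      rw [← Complex.exp_add, ← mul_add]
      refine hnorm _ ?_
      rw [Complex.add_im]
      have := τ.im_pos
      change 0 < τ.im + _
      linarith
    have h5 : qPoch (Complex.exp (2 * Real.pi * Complex.I * τ))
        (Complex.exp (2 * Real.pi * Complex.I * (τ - (u - n * τ)))) ≠ 0 := by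
      refine qPoch_ne_zero (norm_nome_lt_one τ) (hnorm _ ?_)
      rw [Complex.sub_im]
      change 0 < τ.im - _
      linarith
    have h6 := (mul_eq_zero.1 h3).resolve_right (mul_ne_zero h4 h5)
    obtain ⟨k, hk⟩ := Complex.exp_eq_one_iff.1 (sub_eq_zero.1 h6).symm
    have h7 : u - n * τ = k := by
      have h8 : (2 * (Real.pi : ℂ) * Complex.I) * (u - n * τ) =
          (2 * (Real.pi : ℂ) * Complex.I) * k := by rw [hk]; ring
      exact mul_left_cancel₀ Complex.two_pi_I_ne_zero h8
    rw [← sub_add_cancel u (n * τ), h7]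
    exact add_mem (intCast_mem_lattice τ k) (intCast_mul_tau_mem_lattice τ n)
  · intro h
    obtain ⟨e, -, -, he⟩ := exists_sigma_add_lattice τ h
    have h1 : sigma τ 0 = 0 := by rw [sigma_eq]; simp
    have := he 0
    rwa [h1, mul_zero, zero_add] at this

/-- At `0` the factor `1 - exp(2πiu)` has a simple zero and the cofactor does not vanish;
quasi-periodicity carries this to every lattice point. -/
theorem deriv_sigma_ne_zero (τ : UpperHalfPlane) {l : ℂ} (hl : l ∈ lattice τ) :
    deriv (sigma τ) l ≠ 0 := by
  have hq := norm_nome_lt_one τ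
  set q := Complex.exp (2 * Real.pi * Complex.I * τ) with hqdef
  let g : ℂ → ℂ := fun u => qPoch q (q * Complex.exp (2 * Real.pi * Complex.I * u)) *
      qPoch q (Complex.exp (2 * Real.pi * Complex.I * (τ - u)))
  have hE : Differentiable ℂ fun x : ℂ => qPoch q x := by
    simpa using differentiable_qPoch_smul hq (1 : ℂ)
  have hg : Differentiable ℂ g := by
    refine (hE.comp (g := fun x : ℂ => qPoch q x)
      (f := fun u : ℂ => q * Complex.exp (2 * Real.pi * Complex.I * u)) (by fun_prop)).mul
      (hE.comp (g := fun x : ℂ => qPoch q x)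
      (f := fun u : ℂ => Complex.exp (2 * Real.pi * Complex.I * (τ - u))) (by fun_prop))
  have hg0 : g 0 ≠ 0 := by
    simp only [g, mul_zero, Complex.exp_zero, mul_one, sub_zero]
    exact mul_ne_zero (qPoch_ne_zero hq hq) (qPoch_ne_zero hq hq)
  have h0 : HasDerivAt (sigma τ) (-(2 * Real.pi * Complex.I) * g 0) 0 := by
    have h1 : HasDerivAt (fun u : ℂ => 1 - Complex.exp (2 * Real.pi * Complex.I * u))
        (-(2 * Real.pi * Complex.I)) 0 := by
      have h2 := (((hasDerivAt_id (0 : ℂ)).const_mul (2 * Real.pi * Complex.I)).cexp).const_sub 1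
      simpa using h2
    have h3 := h1.mul (hg 0).hasDerivAt
    have h4 : sigma τ = fun u => (1 - Complex.exp (2 * Real.pi * Complex.I * u)) * g u := by
      ext u; exact sigma_eq τ u
    rw [h4]
    simpa using! h3
  obtain ⟨e, hed, he0, he⟩ := exists_sigma_add_lattice τ hl
  have hs0 : sigma τ 0 = 0 := (sigma_eq_zero_iff τ 0).2 (zero_mem _)
  have h5 : HasDerivAt (fun u => sigma τ (u + l)) (e 0 * (-(2 * Real.pi * Complex.I) * g 0)) 0 := by
    have h6 := (hed 0).hasDerivAt.mul h0
    rw [hs0, mul_zero, zero_add] at h6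
    have h7 : (fun u => sigma τ (u + l)) = e * sigma τ := by ext u; exact he u
    rw [h7]
    exact h6
  have h8 : deriv (fun u => sigma τ (u + l)) 0 = deriv (sigma τ) l := by
    rw [deriv_comp_add_const, zero_add]
  rw [← h8, h5.deriv]
  exact mul_ne_zero (he0 0) (mul_ne_zero (neg_ne_zero.2 Complex.two_pi_I_ne_zero) hg0)

theorem analyticAt_sigma_sub (τ : UpperHalfPlane) (a p : ℂ) :
    AnalyticAt ℂ (fun u => sigma τ (u - a)) p :=
  Differentiable.analyticAt ((differentiable_sigma τ).comp (differentiable_id.sub_const a)) p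

open Classical in
theorem meromorphicOrderAt_sigma_sub (τ : UpperHalfPlane) (a p : ℂ) :
    meromorphicOrderAt (fun u => sigma τ (u - a)) p =
      ((if p - a ∈ lattice τ then 1 else 0 : ℤ) : WithTop ℤ) := by
  have han := analyticAt_sigma_sub τ a p
  rw [han.meromorphicOrderAt_eq]
  split_ifs with h
  · have h1 : analyticOrderAt (fun u => sigma τ (u - a)) p = 1 := by
      refine han.analyticOrderAt_eq_one_of_zero_deriv_ne_zero ((sigma_eq_zero_iff τ _).2 h) ?_
      rw [deriv_comp_sub_const]
      exact deriv_sigma_ne_zero τ h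
    rw [h1]
    rfl
  · have h1 : analyticOrderAt (fun u => sigma τ (u - a)) p = 0 :=
      han.analyticOrderAt_eq_zero.2 fun h0 => h ((sigma_eq_zero_iff τ _).1 h0)
    rw [h1]
    rfl

/-! ### Simple zeros of a determinant. -/

theorem hasDerivAt_det {r : ℕ} {A : ℂ → Matrix (Fin r) (Fin r) ℂ} {A' : Matrix (Fin r) (Fin r) ℂ}
    {p : ℂ} (hA : ∀ i j, HasDerivAt (fun u => A u i j) (A' i j) p) :
    HasDerivAt (fun u => (A u).det) (∑ i, ((A p).updateRow i (A' i)).det) p := by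
  let D : ContinuousMultilinearMap ℂ (fun _ : Fin r => Fin r → ℂ) ℂ :=
    { Matrix.detRowAlternating.toMultilinearMap with
      cont := (continuous_id (X := Matrix (Fin r) (Fin r) ℂ)).matrix_det }
  let B : ℂ → Fin r → Fin r → ℂ := fun u i j => A u i j
  let B' : Fin r → Fin r → ℂ := fun i j => A' i j
  have hB : HasDerivAt B B' p := hasDerivAt_pi.2 fun i => hasDerivAt_pi.2 fun j => hA i j
  have h := (D.hasFDerivAt (B p)).comp_hasDerivAt p hB
  have h2 : D.linearDeriv (B p) B' = ∑ i, ((A p).updateRow i (A' i)).det :=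
    D.linearDeriv_apply (B p) B'
  rw [h2] at h
  exact h

/-- If the determinant has a simple zero at a point, the kernel there is a line. -/
theorem exists_ker_eq_span_singleton {r : ℕ} {A : ℂ → Matrix (Fin r) (Fin r) ℂ} {p : ℂ}
    (hA : ∀ i j, DifferentiableAt ℂ (fun u => A u i j) p) (h0 : (A p).det = 0)
    (h1 : deriv (fun u => (A u).det) p ≠ 0) :
    ∃ x : Fin r → ℂ, x ≠ 0 ∧ LinearMap.ker (A p).mulVecLin = Submodule.span ℂ {x} := by
  -- Transposing turns the expansion by rows into one by columns, as needed for a right kernel.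
  have hd : HasDerivAt (fun u => (A u).transpose.det)
      (∑ j, ((A p).transpose.updateRow j fun i : Fin r => deriv (fun u => A u i j) p).det) p :=
    hasDerivAt_det (A := fun u => (A u).transpose)
      (A' := Matrix.of fun j i => deriv (fun u => A u i j) p) fun j i => (hA i j).hasDerivAt
  simp only [Matrix.det_transpose] at hd
  rw [hd.deriv] at h1
  obtain ⟨j, -, hj⟩ := Finset.exists_ne_zero_of_sum_ne_zero h1
  rw [Matrix.updateRow_transpose, Matrix.det_transpose] at hj
  -- Replacing column `j` of `A p` by its derivative gives an invertible matrix. A kernel vector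
  -- with `v j = 0` does not see that column, so the `j`-th coordinate is injective on the kernel.
  have key : ∀ v, (A p).mulVec v = 0 → v j = 0 → v = 0 := by
    intro v hv hvj
    refine Matrix.eq_zero_of_mulVec_eq_zero hj ?_
    rw [← hv]
    ext i
    simp only [Matrix.mulVec, dotProduct]
    refine Finset.sum_congr rfl fun k _ => ?_
    by_cases hk : k = j
    · subst hk; simp [hvj]
    · rw [Matrix.updateCol_ne hk]
  obtain ⟨x, hx, hAx⟩ := Matrix.exists_mulVec_eq_zero_iff.2 h0
  refine ⟨x, hx, le_antisymm ?_ ?_⟩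
  · intro v hv
    have hv' : (A p).mulVec v = 0 := hv
    have hxj : x j ≠ 0 := fun h => hx (key x hAx h)
    rw [Submodule.mem_span_singleton]
    refine ⟨v j / x j, ?_⟩
    have := key (v - (v j / x j) • x) (by rw [Matrix.mulVec_sub, Matrix.mulVec_smul, hv', hAx]; simp)
      (by simp [hxj])
    exact (sub_eq_zero.1 this).symm
  · rw [Submodule.span_singleton_le_iff_mem]
    exact hAx

/-! ### Columns divided by theta functions, and interpolation of null-pole data. -/

open Classical in
theorem meromorphicOrderAt_prod_sigma {ι : Type*} (τ : UpperHalfPlane) (s : Finset ι) (a : ι → ℂ)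
    (p : ℂ) : meromorphicOrderAt (fun u => ∏ k ∈ s, sigma τ (u - a k)) p =
      ((∑ k ∈ s, if p - a k ∈ lattice τ then 1 else 0 : ℤ) : WithTop ℤ) := by
  rw [meromorphicOrderAt_fun_prod fun k _ => (analyticAt_sigma_sub τ (a k) p).meromorphicAt]
  simp only [meromorphicOrderAt_sigma_sub]
  push_cast
  rfl

/-- The matrix function with entries `G i j` divided by theta functions vanishing at the points
`w k` with `col k = j`. -/
def divColumns (τ : UpperHalfPlane) {r N : ℕ} (G : ℂ → Matrix (Fin r) (Fin r) ℂ) (w : Fin N → ℂ)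
    (col : Fin N → Fin r) (u : ℂ) : Matrix (Fin r) (Fin r) ℂ :=
  G u * Matrix.diagonal fun j => (∏ k with col k = j, sigma τ (u - w k))⁻¹

theorem divColumns_apply (τ : UpperHalfPlane) {r N : ℕ} (G : ℂ → Matrix (Fin r) (Fin r) ℂ)
    (w : Fin N → ℂ) (col : Fin N → Fin r) (u : ℂ) (i j : Fin r) :
    divColumns τ G w col u i j = G u i j * (∏ k with col k = j, sigma τ (u - w k))⁻¹ := by
  simp [divColumns, Matrix.mul_diagonal]

theorem det_divColumns (τ : UpperHalfPlane) {r N : ℕ} (G : ℂ → Matrix (Fin r) (Fin r) ℂ)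
    (w : Fin N → ℂ) (col : Fin N → Fin r) (u : ℂ) :
    (divColumns τ G w col u).det = (G u).det * (∏ k, sigma τ (u - w k))⁻¹ := by
  rw [divColumns, Matrix.det_mul, Matrix.det_diagonal, Finset.prod_inv_distrib,
    Finset.prod_fiberwise]

theorem prod_sigma_ne_zero {τ : UpperHalfPlane} {ι : Type*} {s : Finset ι} {a : ι → ℂ} {p : ℂ}
    (h : ∀ k ∈ s, p - a k ∉ lattice τ) : ∏ k ∈ s, sigma τ (p - a k) ≠ 0 :=
  Finset.prod_ne_zero_iff.2 fun k hk h0 => h k hk ((sigma_eq_zero_iff τ _).1 h0)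

theorem analyticAt_prod_sigma (τ : UpperHalfPlane) {ι : Type*} (s : Finset ι) (a : ι → ℂ) (p : ℂ) :
    AnalyticAt ℂ (fun u => ∏ k ∈ s, sigma τ (u - a k)) p :=
  Finset.analyticAt_fun_prod s fun k _ => analyticAt_sigma_sub τ (a k) p

theorem eventually_sigma_ne_zero (τ : UpperHalfPlane) (a p : ℂ) :
    ∀ᶠ u in 𝓝[≠] p, sigma τ (u - a) ≠ 0 := by
  have h := (analyticAt_sigma_sub τ a p).meromorphicAt
  rw [← meromorphicOrderAt_ne_top_iff_eventually_ne_zero h, meromorphicOrderAt_sigma_sub]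
  exact WithTop.coe_ne_top

section Assembly

variable {τ : UpperHalfPlane} {r N : ℕ} {G : ℂ → Matrix (Fin r) (Fin r) ℂ} {e : ℂ → ℂ}
  {z w : Fin N → ℂ} {col : Fin N → Fin r}

open Classical in
theorem meromorphicOrderAt_det_divColumns (he : Differentiable ℂ e) (he0 : ∀ u, e u ≠ 0)
    (hdet : ∀ u, (G u).det = e u * ∏ k, sigma τ (u - z k)) (p : ℂ) :
    meromorphicOrderAt (fun u => (divColumns τ G w col u).det) p =
      (((∑ k, if p - z k ∈ lattice τ then 1 else 0) -
        ∑ k, if p - w k ∈ lattice τ then 1 else 0 : ℤ) : WithTop ℤ) := by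
  have h1 : (fun u => (divColumns τ G w col u).det) =
      fun u => e u * ((∏ k, sigma τ (u - z k)) * (∏ k, sigma τ (u - w k))⁻¹) := by
    ext u
    rw [det_divColumns, hdet, mul_assoc]
  have hz := (analyticAt_prod_sigma τ Finset.univ z p).meromorphicAt
  have hw := (analyticAt_prod_sigma τ Finset.univ w p).meromorphicAt
  rw [h1]
  have h2 := meromorphicOrderAt_mul_of_ne_zero
    (f := fun u => (∏ k, sigma τ (u - z k)) * (∏ k, sigma τ (u - w k))⁻¹)
    (he.analyticAt p) (he0 p)
  refine h2.trans ?_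
  refine (meromorphicOrderAt_mul hz hw.inv).trans ?_
  rw [meromorphicOrderAt_inv, meromorphicOrderAt_prod_sigma, meromorphicOrderAt_prod_sigma, sub_eq_add_neg]
  rfl

/-- The numerators are entire, and at most one `w k` is congruent to a given point, so the
denominator vanishes there to order at most one. -/
theorem pole_divColumns (hG : ∀ i j, Differentiable ℂ fun u => G u i j)
    (hw : ∀ k k', w k - w k' ∈ lattice τ → k = k') (i j : Fin r) (p : ℂ)
    (hp : meromorphicOrderAt (fun u => divColumns τ G w col u i j) p < 0) :
    (∃ k, p - w k ∈ lattice τ) ∧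
      meromorphicOrderAt (fun u => divColumns τ G w col u i j) p = ((-1 : ℤ) : WithTop ℤ) := by
  classical
  have h1 : (fun u => divColumns τ G w col u i j) =
      fun u => G u i j * (∏ k with col k = j, sigma τ (u - w k))⁻¹ := by
    ext u; exact divColumns_apply _ _ _ _ _ _ _
  have hGa := (hG i j).analyticAt p
  have hwm := (analyticAt_prod_sigma τ (Finset.univ.filter fun k => col k = j) w p).meromorphicAt
  have h2 : meromorphicOrderAt (fun u => divColumns τ G w col u i j) p =
      meromorphicOrderAt (fun u => G u i j) p +
        ((-(∑ k with col k = j, if p - w k ∈ lattice τ then 1 else 0 : ℤ) : ℤ) : WithTop ℤ) := by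
    rw [h1]
    refine (meromorphicOrderAt_mul hGa.meromorphicAt hwm.inv).trans ?_
    rw [meromorphicOrderAt_inv, meromorphicOrderAt_prod_sigma]
    rfl
  have h3 := hGa.meromorphicOrderAt_nonneg
  have h4 : (∑ k with col k = j, if p - w k ∈ lattice τ then 1 else 0 : ℤ) ≤ 1 := by
    rw [Finset.sum_boole]
    have : (Finset.filter (fun k => p - w k ∈ lattice τ)
        (Finset.univ.filter fun k => col k = j)).card ≤ 1 := by
      refine Finset.card_le_one.2 fun a ha b hb => hw a b ?_
      have := sub_mem (Finset.mem_filter.1 hb).2 (Finset.mem_filter.1 ha).2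
      simpa using this
    exact_mod_cast this
  have h5 : (∀ k, p - w k ∉ lattice τ) →
      (∑ k with col k = j, if p - w k ∈ lattice τ then 1 else 0 : ℤ) = 0 :=
    fun hne => Finset.sum_eq_zero fun k _ => if_neg (hne k)
  rw [h2] at hp ⊢
  clear h2
  generalize (∑ k with col k = j, if p - w k ∈ lattice τ then 1 else 0 : ℤ) = S at *
  generalize meromorphicOrderAt (fun u => G u i j) p = o at *
  cases o with
  | top => simp at hp
  | coe m =>
    norm_cast at hp h3 ⊢
    refine ⟨?_, by omega⟩
    by_contra hne
    push Not at hne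
    have := h5 hne
    omega

theorem analyticAt_divColumns (hG : ∀ i j, Differentiable ℂ fun u => G u i j) {p : ℂ}
    (hp : ∀ k, p - w k ∉ lattice τ) (i j : Fin r) :
    AnalyticAt ℂ (fun u => divColumns τ G w col u i j) p := by
  have h1 : (fun u => divColumns τ G w col u i j) =
      fun u => G u i j * (∏ k with col k = j, sigma τ (u - w k))⁻¹ := by
    ext u; exact divColumns_apply _ _ _ _ _ _ _
  rw [h1]
  exact ((hG i j).analyticAt p).mul
    ((analyticAt_prod_sigma τ _ w p).inv (prod_sigma_ne_zero fun k _ => hp k))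

theorem analyticAt_det {r : ℕ} {A : ℂ → Matrix (Fin r) (Fin r) ℂ} {p : ℂ}
    (hA : ∀ i j, AnalyticAt ℂ (fun u => A u i j) p) : AnalyticAt ℂ (fun u => (A u).det) p := by
  simp only [Matrix.det_apply]
  refine Finset.analyticAt_fun_sum _ fun σ _ => ?_
  simp only [Units.smul_def, zsmul_eq_mul]
  refine analyticAt_const.mul ?_
  exact Finset.analyticAt_fun_prod _ fun i _ => hA _ _

theorem analyticAt_nonsing_inv {r : ℕ} {A : ℂ → Matrix (Fin r) (Fin r) ℂ} {p : ℂ}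
    (hA : ∀ i j, AnalyticAt ℂ (fun u => A u i j) p) (hp : (A p).det ≠ 0) (i j : Fin r) :
    AnalyticAt ℂ (fun u => (A u)⁻¹ i j) p := by
  simp only [Matrix.inv_def, Ring.inverse_eq_inv', Matrix.smul_apply, smul_eq_mul,
    Matrix.adjugate_apply]
  refine ((analyticAt_det hA).inv hp).mul (analyticAt_det fun a b => ?_)
  simp only [Matrix.updateRow_apply]
  split_ifs
  · exact analyticAt_const
  · exact hA _ _

theorem deriv_ne_zero_of_meromorphicOrderAt_eq_one {f : ℂ → ℂ} {p : ℂ} (hf : AnalyticAt ℂ f p)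
    (h : meromorphicOrderAt f p = ((1 : ℤ) : WithTop ℤ)) : f p = 0 ∧ deriv f p ≠ 0 := by
  rw [hf.meromorphicOrderAt_eq] at h
  have h1 : analyticOrderAt f p = 1 := by
    generalize analyticOrderAt f p = o at h
    cases o with
    | top => simp at h
    | coe n =>
      have : ((n : ℤ) : WithTop ℤ) = ((1 : ℤ) : WithTop ℤ) := h
      norm_cast at this
      rw [this]; rfl
  have h0 : f p = 0 := apply_eq_zero_of_analyticOrderAt_ne_zero (by rw [h1]; exact one_ne_zero)
  refine ⟨h0, ?_⟩
  have h2 := hf.analyticOrderAt_deriv_add_one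
  simp only [h0, sub_zero] at h2
  rw [show (fun y => f y) = f from rfl, h1] at h2
  have h3 : analyticOrderAt (deriv f) p = 0 := by
    generalize analyticOrderAt (deriv f) p = o at h2
    cases o with
    | top => simp at h2
    | coe n =>
      norm_cast at h2 ⊢
      omega
  exact hf.deriv.analyticOrderAt_eq_zero.1 h3

/-- Cancelling the invertible `B` leaves the kernel of a diagonal matrix with one zero entry. At a
pole of `F = G * diagonal d⁻¹` this is applied to `F⁻¹ = diagonal d * G⁻¹`. -/
theorem ker_vecMulLinear_diagonal_mul {r : ℕ} {d : Fin r → ℂ} {B : Matrix (Fin r) (Fin r) ℂ}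
    {j : Fin r} (hB : IsUnit B.det) (hd : ∀ i, d i = 0 ↔ i = j) :
    LinearMap.ker (Matrix.diagonal d * B).vecMulLinear = Submodule.span ℂ {Pi.single j (1 : ℂ)} := by
  ext v
  rw [LinearMap.mem_ker, Submodule.mem_span_singleton, Matrix.vecMulLinear_apply,
    ← Matrix.vecMul_vecMul]
  constructor
  · intro h
    have h1 : Matrix.vecMul v (Matrix.diagonal d) = 0 := by
      have := congrArg (fun x => Matrix.vecMul x B⁻¹) h
      simpa [Matrix.vecMul_vecMul, mul_assoc, Matrix.mul_nonsing_inv _ hB] using this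
    refine ⟨v j, ?_⟩
    ext i
    by_cases hij : i = j
    · subst hij; simp
    · have h2 := congrFun h1 i
      rw [Matrix.vecMul_diagonal, Pi.zero_apply] at h2
      have h3 := (mul_eq_zero.1 h2).resolve_right fun h => hij ((hd i).1 h)
      simp [hij, h3]
  · rintro ⟨a, rfl⟩
    have h1 : Matrix.vecMul (a • Pi.single j (1 : ℂ)) (Matrix.diagonal d) = 0 := by
      ext i
      rw [Matrix.vecMul_diagonal]
      by_cases hij : i = j
      · simp [(hd i).2 hij]
      · simp [hij]
    rw [h1, Matrix.zero_vecMul]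

theorem isUnit_det_mat {n : Type} [Fintype n] [DecidableEq n] (ξ : FlatFactor τ n)
    (l : lattice τ) : IsUnit (ξ.mat l).det :=
  (Matrix.isUnit_iff_isUnit_det _).1 (Units.isUnit _)

/-- An automorphic matrix function whose columns are quotients of entire functions by theta
functions, with the obvious determinant, is a trivialization interpolating null-pole data. -/
theorem exists_interpolates_divColumns {ξ : FlatFactor τ (Fin r)}
    (hG : ∀ i j, Differentiable ℂ fun u => G u i j) (he : Differentiable ℂ e) (he0 : ∀ u, e u ≠ 0)
    (hdet : ∀ u, (G u).det = e u * ∏ k, sigma τ (u - z k))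
    (hdist : ∀ a b, Sum.elim z w a - Sum.elim z w b ∈ lattice τ → a = b)
    (haut : ∀ (l : lattice τ) (u : ℂ),
      divColumns τ G w col (u + l) = ξ.mat l * divColumns τ G w col u) :
    ∃ (D : SimpleNullPoleData τ r N) (F : ℂ → Matrix (Fin r) (Fin r) ℂ),
      IsTrivialization ξ F ∧ Interpolates D F := by
  classical
  set F := divColumns τ G w col with hF
  -- The theta factors keep the original points; only the interpolation data use their
  -- representatives in the fundamental domain.
  choose z₀ hz₀P hz₀ using fun k => exists_sub_mem_fundamentalDomain τ (z k)
  choose w₀ hw₀P hw₀ using fun k => exists_sub_mem_fundamentalDomain τ (w k)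
  have hred : ∀ {a b p : ℂ}, a - b ∈ lattice τ → (p - a ∈ lattice τ ↔ p - b ∈ lattice τ) := by
    intro a b p hab
    rw [← sub_add_sub_cancel p a b, add_mem_cancel_right hab]
  have hzz : ∀ (k : Fin N) (l : lattice τ) (k' : Fin N),
      z₀ k + l - z k' ∈ lattice τ → k = k' := by
    intro k l k' h
    have h1 := hdist (Sum.inl k) (Sum.inl k') (by
      have := sub_mem (add_mem (hz₀ k) h) l.2
      convert this using 1
      simp
      ring)
    simpa using h1
  have hzw : ∀ (k : Fin N) (l : lattice τ) (k' : Fin N), z₀ k + l - w k' ∉ lattice τ := by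
    intro k l k' h
    have h1 := hdist (Sum.inl k) (Sum.inr k') (by
      have := sub_mem (add_mem (hz₀ k) h) l.2
      convert this using 1
      simp
      ring)
    simp at h1
  have hww : ∀ (k : Fin N) (l : lattice τ) (k' : Fin N),
      w₀ k + l - w k' ∈ lattice τ → k = k' := by
    intro k l k' h
    have h1 := hdist (Sum.inr k) (Sum.inr k') (by
      have := sub_mem (add_mem (hw₀ k) h) l.2
      convert this using 1
      simp
      ring)
    simpa using h1
  have hwz : ∀ (k : Fin N) (l : lattice τ) (k' : Fin N), w₀ k + l - z k' ∉ lattice τ := by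
    intro k l k' h
    have h1 := hdist (Sum.inr k) (Sum.inl k') (by
      have := sub_mem (add_mem (hw₀ k) h) l.2
      convert this using 1
      simp
      ring)
    simp at h1
  have hwself : ∀ (k : Fin N) (l : lattice τ), w₀ k + l - w k ∈ lattice τ := by
    intro k l
    have := sub_mem l.2 (hw₀ k)
    convert this using 1
    ring
  have hmero : IsMeromorphicMatrix F := by
    intro i j u
    have h1 : (fun u => F u i j) =
        fun u => G u i j * (∏ k with col k = j, sigma τ (u - w k))⁻¹ := by
      ext u; exact divColumns_apply _ _ _ _ _ _ _
    rw [h1]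
    exact ((hG i j).analyticAt u).meromorphicAt.mul
      (analyticAt_prod_sigma τ _ w u).meromorphicAt.inv
  have hord := fun p => meromorphicOrderAt_det_divColumns (col := col) (w := w) he he0 hdet p
  have hx : ∀ k, ∃ x : Fin r → ℂ, x ≠ 0 ∧
      LinearMap.ker (F (z₀ k)).mulVecLin = Submodule.span ℂ {x} := by
    intro k
    have han : ∀ i j, AnalyticAt ℂ (fun u => F u i j) (z₀ k) :=
      analyticAt_divColumns hG fun k' h => hzw k 0 k' (by simpa using h)
    have h1 := hord (z₀ k)
    have h2 : (∑ k', if z₀ k - z k' ∈ lattice τ then (1 : ℤ) else 0) = 1 := by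
      rw [Finset.sum_eq_single k, if_pos]
      · have := neg_mem (hz₀ k); simpa using this
      · intro k' _ hk'
        exact if_neg fun h => hk' (hzz k 0 k' (by simpa using h)).symm
      · simp
    have h3 : (∑ k', if z₀ k - w k' ∈ lattice τ then (1 : ℤ) else 0) = 0 :=
      Finset.sum_eq_zero fun k' _ => if_neg fun h => hzw k 0 k' (by simpa using h)
    rw [h2, h3, sub_zero] at h1
    obtain ⟨h4, h5⟩ := deriv_ne_zero_of_meromorphicOrderAt_eq_one (analyticAt_det han) h1
    exact exists_ker_eq_span_singleton (fun i j => (han i j).differentiableAt) h4 h5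
  choose x hx0 hxker using hx
  let D : SimpleNullPoleData τ r N :=
    { z := z₀
      w := w₀
      x := x
      y := fun k => Pi.single (col k) 1
      z_mem := hz₀P
      w_mem := hw₀P
      distinct := by
        intro a b hab
        apply hdist
        have h1 : ∀ c, Sum.elim z w c - Sum.elim z₀ w₀ c ∈ lattice τ := by
          rintro (c | c)
          · exact hz₀ c
          · exact hw₀ c
        have := sub_mem (h1 a) (h1 b)
        rw [hab] at this
        simpa using this
      x_ne_zero := hx0
      y_ne_zero := fun k => by simp }
  have hdomz : ∀ u ∈ fundamentalDomain τ, ∀ k, u - z k ∈ lattice τ ↔ z₀ k = u := by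
    intro u hu k
    rw [hred (hz₀ k)]
    exact ⟨fun h => (eq_of_sub_mem_lattice hu (hz₀P k) h).symm, fun h => by simp [h]⟩
  have hdomw : ∀ u ∈ fundamentalDomain τ, ∀ k, u - w k ∈ lattice τ ↔ w₀ k = u := by
    intro u hu k
    rw [hred (hw₀ k)]
    exact ⟨fun h => (eq_of_sub_mem_lattice hu (hw₀P k) h).symm, fun h => by simp [h]⟩
  refine ⟨D, F, ⟨hmero, ?_, fun l => Filter.Eventually.of_forall (haut l)⟩, hmero, ?_, ?_, ?_, ?_⟩
  · intro h
    have h1 : (fun u => (F u).det) =ᶠ[𝓝[≠] 0] fun _ => 0 := by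
      have := mem_codiscreteWithin_iff_forall_mem_nhdsNE.1 h 0 (Set.mem_univ _)
      simpa using! this
    have h2 : meromorphicOrderAt (fun u => (F u).det) 0 = ⊤ := meromorphicOrderAt_eq_top_iff.2 h1
    rw [hord] at h2
    exact WithTop.coe_ne_top h2
  · intro u hu
    rw [hord]
    simp only [hdomz u hu, hdomw u hu]
    rfl
  · intro i j u hu
    obtain ⟨⟨k, hk⟩, h2⟩ := pole_divColumns (col := col) hG
      (fun k k' h => by simpa using hdist (Sum.inr k) (Sum.inr k') h) i j u hu
    exact ⟨⟨k, ⟨u - w₀ k, (hred (hw₀ k)).1 hk⟩, by simp [D]⟩, h2⟩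
  · intro k l
    refine ⟨F (z₀ k + l), ⟨F, analyticAt_divColumns hG (hzw k l), Filter.EventuallyEq.rfl, rfl⟩, ?_⟩
    -- Left multiplication by the invertible `ξ(l)` does not change the right kernel, so the one at
    -- `z₀ k` serves for all translates.
    rw [haut l, Matrix.mulVecLin_mul, LinearMap.ker_comp_of_ker_eq_bot, hxker]
    rw [Matrix.ker_mulVecLin_eq_bot_iff]
    intro v hv
    exact Matrix.eq_zero_of_mulVec_eq_zero (isUnit_det_mat ξ l).ne_zero hv
  · intro k l
    set p := w₀ k + (l : ℂ) with hp
    let d : ℂ → Fin r → ℂ := fun u j => ∏ k' with col k' = j, sigma τ (u - w k')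
    have hGp : (G p).det ≠ 0 := by
      rw [hdet]
      exact mul_ne_zero (he0 p) (prod_sigma_ne_zero fun k' _ => hwz k l k')
    refine ⟨Matrix.diagonal (d p) * (G p)⁻¹,
      ⟨fun u => Matrix.diagonal (d u) * (G u)⁻¹, fun i j => ?_, ?_, rfl⟩, ?_⟩
    · simp only [Matrix.diagonal_mul]
      exact (analyticAt_prod_sigma τ _ w p).mul
        (analyticAt_nonsing_inv (fun i j => (hG i j).analyticAt p) hGp i j)
    · have h1 : ∀ᶠ u in 𝓝[≠] p, ∀ k', sigma τ (u - w k') ≠ 0 :=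
        Filter.eventually_all.2 fun k' => eventually_sigma_ne_zero τ (w k') p
      filter_upwards [h1] with u hu
      have hdu : ∀ j, d u j ≠ 0 := fun j => Finset.prod_ne_zero_iff.2 fun k' _ => hu k'
      rw [hF, divColumns, Matrix.mul_inv_rev]
      congr 1
      symm
      refine Matrix.inv_eq_left_inv ?_
      rw [Matrix.diagonal_mul_diagonal, ← Matrix.diagonal_one]
      congr 1
      ext j
      exact mul_inv_cancel₀ (hdu j)
    · refine ker_vecMulLinear_diagonal_mul (Matrix.isUnit_nonsing_inv_det _ hGp.isUnit)
        fun i => ⟨fun h => ?_, ?_⟩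
      · obtain ⟨k', hk', h0⟩ := Finset.prod_eq_zero_iff.1 h
        rw [hww k l k' ((sigma_eq_zero_iff τ _).1 h0)]
        exact (Finset.mem_filter.1 hk').2.symm
      · rintro rfl
        exact Finset.prod_eq_zero (Finset.mem_filter.2 ⟨Finset.mem_univ k, rfl⟩)
          ((sigma_eq_zero_iff τ _).2 (hwself k l))

end Assembly

/-! ### Matrix theta functions of triangular matrices. -/

theorem mul_apply_diag_of_isUpperTriangular {r : ℕ} {A B : Matrix (Fin r) (Fin r) ℂ}
    (hA : A.IsUpperTriangular) (hB : B.IsUpperTriangular) (j : Fin r) :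
    (A * B) j j = A j j * B j j := by
  rw [Matrix.mul_apply]
  refine Finset.sum_eq_single j (fun k _ hk => ?_) (by simp)
  rcases lt_or_gt_of_ne hk with h | h
  · rw [hA h, zero_mul]
  · rw [hB h, mul_zero]

theorem pow_isUpperTriangular {r : ℕ} {A : Matrix (Fin r) (Fin r) ℂ} (hA : A.IsUpperTriangular)
    (n : ℕ) : (A ^ n).IsUpperTriangular ∧ ∀ j, (A ^ n) j j = A j j ^ n := by
  induction n with
  | zero => exact ⟨by rw [pow_zero]; exact Matrix.blockTriangular_one, by simp⟩
  | succ n ih =>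
    refine ⟨by rw [pow_succ]; exact ih.1.mul hA, fun j => ?_⟩
    rw [pow_succ, mul_apply_diag_of_isUpperTriangular ih.1 hA, ih.2, pow_succ]

theorem smul_isUpperTriangular {r : ℕ} {A : Matrix (Fin r) (Fin r) ℂ} (a : ℂ)
    (hA : A.IsUpperTriangular) : (a • A).IsUpperTriangular := by
  intro i j hij
  rw [Matrix.smul_apply, hA hij, smul_zero]

attribute [local instance] Matrix.linftyOpNormedRing Matrix.linftyOpNormedAlgebra

theorem hasSum_qPoch_apply {r : ℕ} {q : ℂ} (hq : ‖q‖ < 1) (Y : Matrix (Fin r) (Fin r) ℂ)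
    (i j : Fin r) : HasSum (fun n => qPochCoeff q n * (Y ^ n) i j) (qPoch q Y i j) :=
  (summable_qPoch hq Y).hasSum.map (Matrix.entryAddMonoidHom ℂ i j) (continuous_id.matrix_elem i j)

theorem qPoch_isUpperTriangular {r : ℕ} {q : ℂ} (hq : ‖q‖ < 1) {Y : Matrix (Fin r) (Fin r) ℂ}
    (hY : Y.IsUpperTriangular) :
    (qPoch q Y).IsUpperTriangular ∧ ∀ j, qPoch q Y j j = qPoch q (Y j j) := by
  constructor
  · intro i j hij
    have h := hasSum_qPoch_apply hq Y i j
    simp only [(pow_isUpperTriangular hY _).1 hij, mul_zero] at h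
    exact h.unique hasSum_zero
  · intro j
    have h := hasSum_qPoch_apply hq Y j j
    simp only [(pow_isUpperTriangular hY _).2] at h
    exact h.unique (summable_qPoch hq (Y j j)).hasSum

theorem inv_isUpperTriangular {r : ℕ} {V : GL (Fin r) ℂ} (hV : V.val.IsUpperTriangular) :
    (V⁻¹).val.IsUpperTriangular := by
  have h1 : (V⁻¹).val = V.val⁻¹ := by simp
  have : Invertible V.val := V.invertible
  rw [h1]
  exact Matrix.blockTriangular_inv_of_blockTriangular hV

/-- The matrix valued theta function with multiplier `V`. -/
def thetaMat (τ : UpperHalfPlane) {r : ℕ} (V : GL (Fin r) ℂ) (u : ℂ) :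
    Matrix (Fin r) (Fin r) ℂ := thetaAlg τ V⁻¹ u

section ThetaMat

variable (τ : UpperHalfPlane) {r : ℕ} (V : GL (Fin r) ℂ)

theorem differentiable_thetaMat_apply (i j : Fin r) :
    Differentiable ℂ fun u => thetaMat τ V u i j := by
  have h := differentiable_thetaAlg τ (𝔸 := Matrix (Fin r) (Fin r) ℂ) V⁻¹
  let L : Matrix (Fin r) (Fin r) ℂ →L[ℂ] ℂ :=
    ⟨Matrix.entryLinearMap ℂ ℂ i j, continuous_id.matrix_elem i j⟩
  exact L.differentiable.comp h

theorem thetaMat_add_one (u : ℂ) : thetaMat τ V (u + 1) = thetaMat τ V u := thetaAlg_add_one τ _ u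

theorem thetaMat_add_tau (u : ℂ) : thetaMat τ V (u + τ) =
    (-Complex.exp (-(2 * Real.pi * Complex.I * u))) • (V.val * thetaMat τ V u) := by
  have := thetaAlg_add_tau τ V⁻¹ u
  rwa [inv_inv] at this

variable {V}

theorem thetaMat_isUpperTriangular (hV : V.val.IsUpperTriangular) (u : ℂ) :
    (thetaMat τ V u).IsUpperTriangular := by
  have hq := norm_nome_lt_one τ
  have h1 := (qPoch_isUpperTriangular hq (smul_isUpperTriangular
    (Complex.exp (2 * Real.pi * Complex.I * u)) (inv_isUpperTriangular hV))).1
  have h2 := (qPoch_isUpperTriangular hq (smul_isUpperTriangular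
    (Complex.exp (2 * Real.pi * Complex.I * (τ - u)))
    (show ((V⁻¹)⁻¹).val.IsUpperTriangular by rwa [inv_inv]))).1
  exact h1.mul h2

theorem exists_thetaMat_diag (hV : V.val.IsUpperTriangular) (j : Fin r) :
    ∃ c : ℂ, V.val j j = Complex.exp (-(2 * Real.pi * Complex.I * c)) ∧
      ∀ u, thetaMat τ V u j j = sigma τ (u + c) := by
  have hq := norm_nome_lt_one τ
  have hVi := inv_isUpperTriangular hV
  have hmul : V.val j j * (V⁻¹).val j j = 1 := by
    rw [← mul_apply_diag_of_isUpperTriangular hV hVi, ← Units.val_mul, mul_inv_cancel]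
    simp
  have hne : V.val j j ≠ 0 := left_ne_zero_of_mul_eq_one hmul
  let w : ℂˣ := ⟨(V⁻¹).val j j, V.val j j, by rw [mul_comm, hmul], hmul⟩
  -- Any logarithm of `V j j` would do; another choice changes `c` by an integer, hence not modulo
  -- the lattice.
  refine ⟨-(Complex.log (V.val j j) / (2 * Real.pi * Complex.I)), ?_, fun u => ?_⟩
  · rw [mul_neg, neg_neg, mul_div_cancel₀ _ Complex.two_pi_I_ne_zero, Complex.exp_log hne]
  · rw [← thetaAlg_unit τ w]
    · have h1 := qPoch_isUpperTriangular hq (smul_isUpperTriangular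
        (Complex.exp (2 * Real.pi * Complex.I * u)) hVi)
      have h2 := qPoch_isUpperTriangular hq (smul_isUpperTriangular
        (Complex.exp (2 * Real.pi * Complex.I * (τ - u)))
        (show ((V⁻¹)⁻¹).val.IsUpperTriangular by rwa [inv_inv]))
      have h3 := mul_apply_diag_of_isUpperTriangular h1.1 h2.1 j
      rw [h1.2, h2.2] at h3
      refine h3.trans ?_
      rw [inv_inv]
      rfl
    · rw [mul_neg, mul_div_cancel₀ _ Complex.two_pi_I_ne_zero, Complex.exp_neg,
        Complex.exp_log hne]
      exact eq_inv_of_mul_eq_one_right hmul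

end ThetaMat

/-! ### Generic translations, and single columns with prescribed zeros and poles. -/

theorem exists_forall_notMem_of_countable {S : Set ℂ} (hS : S.Countable) :
    ∃ d : ℂ, ∀ m : ℤ, m ≠ 0 → (m : ℂ) * d ∉ S := by
  -- The index `m = 0` contributes at most the point `0`, since division by zero is zero.
  have h : (⋃ m : ℤ, (fun s : ℂ => s / m) '' S).Countable :=
    Set.countable_iUnion fun m => hS.image _
  obtain ⟨d, hd⟩ : ∃ d, d ∉ ⋃ m : ℤ, (fun s : ℂ => s / m) '' S := by
    by_contra hne
    push Not at hne
    exact not_countable_complex (h.mono fun x _ => hne x)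
  refine ⟨d, fun m hm hmem => hd (Set.mem_iUnion.2 ⟨m, _, hmem, ?_⟩)⟩
  have : (m : ℂ) ≠ 0 := by exact_mod_cast hm
  field_simp

theorem countable_lattice (τ : UpperHalfPlane) : (lattice τ : Set ℂ).Countable :=
  Set.countable_range _

theorem exists_forall_sub_notMem_lattice (τ : UpperHalfPlane) (s : Finset ℂ) :
    ∃ d : ℂ, ∀ a ∈ s, d - a ∉ lattice τ := by
  have h : (⋃ a ∈ s, (fun l : ℂ => l + a) '' (lattice τ : Set ℂ)).Countable :=
    s.countable_toSet.biUnion fun a _ => (countable_lattice τ).image _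
  obtain ⟨d, hd⟩ := exists_forall_notMem_of_countable h
  have hd1 := hd 1 one_ne_zero
  refine ⟨d, fun a ha hmem => hd1 ?_⟩
  exact Set.mem_biUnion ha ⟨d - a, hmem, by simp⟩

/-- For an upper triangular `V`, there is a section of the flat bundle with multiplier `V` whose
entries below the `j`-th vanish, and whose `j`-th entry has `n` simple zeros `z` while its poles
are at most simple and at `n` further points `w`. -/
def HasColumn (τ : UpperHalfPlane) {r : ℕ} (V : Matrix (Fin r) (Fin r) ℂ) (j : Fin r) (n : ℕ) :
    Prop :=
  ∃ (z w : Fin n → ℂ) (g : ℂ → Fin r → ℂ) (e : ℂ → ℂ),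
    (∀ a b, Sum.elim z w a - Sum.elim z w b ∈ lattice τ → a = b) ∧
    (∀ i, Differentiable ℂ fun u => g u i) ∧ Differentiable ℂ e ∧ (∀ u, e u ≠ 0) ∧
    (∀ u i, j < i → g u i = 0) ∧ (∀ u, g u j = e u * ∏ k, sigma τ (u - z k)) ∧
    (∀ u, (∏ k, sigma τ (u + 1 - w k))⁻¹ • g (u + 1) = (∏ k, sigma τ (u - w k))⁻¹ • g u) ∧
    ∀ u, (∏ k, sigma τ (u + τ - w k))⁻¹ • g (u + τ) =
      V.mulVec ((∏ k, sigma τ (u - w k))⁻¹ • g u)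

section Columns

variable {τ : UpperHalfPlane} {r : ℕ} {V : GL (Fin r) ℂ} {j : Fin r} {c : ℂ}

/-- The `j`-th column of `Θ/σ`: its diagonal entry has its zero at `-c` and its pole at `0`, which
are incongruent exactly when `c ∉ Λ`. -/
theorem hasColumn_one (hV : V.val.IsUpperTriangular)
    (hc : ∀ u, thetaMat τ V u j j = sigma τ (u + c)) (hcΛ : c ∉ lattice τ) :
    HasColumn τ V.val j 1 := by
  refine ⟨fun _ => -c, fun _ => 0, fun u i => thetaMat τ V u i j, fun _ => 1, ?_,
    fun i => differentiable_thetaMat_apply τ V i j, by fun_prop, by simp,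
    fun u i hij => thetaMat_isUpperTriangular τ hV u hij, fun u => by simp [hc], fun u => ?_,
    fun u => ?_⟩
  · rintro (a | a) (b | b) h
    · rw [Subsingleton.elim a b]
    · exact absurd (by simpa using h) hcΛ
    · exact absurd (by simpa using h) hcΛ
    · rw [Subsingleton.elim a b]
  · simp only [sub_zero, sigma_add_one, thetaMat_add_one]
  · simp only [sub_zero, Finset.univ_unique, Finset.prod_const, Finset.card_singleton, pow_one,
      sigma_add_tau, thetaMat_add_tau]
    rw [Matrix.mulVec_smul]
    ext i
    have hE := Complex.exp_ne_zero (-(2 * Real.pi * Complex.I * u))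
    simp only [Pi.smul_apply, Matrix.smul_apply, smul_eq_mul, Matrix.mul_apply, Matrix.mulVec,
      dotProduct]
    rw [mul_inv]
    field_simp

/-- The column is `Θ(u - (d₁ - d₂)) σ(u - d₂) / (σ(u) σ(u - d₁))`. The shifts have equal sums above
and below, so the exponential multipliers cancel. Generic `d₁, d₂` separate zeros and poles for
every `c`. -/
theorem hasColumn_two (hV : V.val.IsUpperTriangular)
    (hc : ∀ u, thetaMat τ V u j j = sigma τ (u + c)) :
    HasColumn τ V.val j 2 := by
  obtain ⟨d₂, hd₂⟩ := exists_forall_sub_notMem_lattice τ {0, -c}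
  -- The excluded classes, with those for `d₂`, are precisely the coincidences among `d₁ - d₂ - c`,
  -- `d₂`, `0` and `d₁`.
  obtain ⟨d₁, hd₁⟩ := exists_forall_sub_notMem_lattice τ {0, d₂, d₂ + c, 2 * d₂ + c}
  simp only [Finset.mem_insert, Finset.mem_singleton, forall_eq_or_imp, forall_eq, sub_zero,
    sub_neg_eq_add] at hd₁ hd₂
  obtain ⟨h1, h2⟩ := hd₂
  obtain ⟨h3, h4, h5, h6⟩ := hd₁
  refine ⟨![d₁ - d₂ - c, d₂], ![0, d₁],
    fun u i => thetaMat τ V (u - (d₁ - d₂)) i j * sigma τ (u - d₂), fun _ => 1, ?_,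
    fun i => ?_, by fun_prop, by simp, fun u i hij => ?_, fun u => ?_, fun u => ?_, fun u => ?_⟩
  · have key : ∀ x y : ℂ, y ∉ lattice τ → (x = y ∨ x = -y) → x ∉ lattice τ := by
      rintro x y hy (rfl | rfl)
      · exact hy
      · rwa [neg_mem_iff]
    have n1 := key (d₁ - d₂ - c - d₂) _ h6 (Or.inl (by ring))
    have n1' := key (d₂ - (d₁ - d₂ - c)) _ h6 (Or.inr (by ring))
    have n2 := key (d₁ - d₂ - c - 0) _ h5 (Or.inl (by ring))
    have n2' := key (0 - (d₁ - d₂ - c)) _ h5 (Or.inr (by ring))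
    have n3 := key (d₁ - d₂ - c - d₁) _ h2 (Or.inr (by ring))
    have n3' := key (d₁ - (d₁ - d₂ - c)) _ h2 (Or.inl (by ring))
    have n4 := key (d₂ - 0) _ h1 (Or.inl (by ring))
    have n4' := key (0 - d₂) _ h1 (Or.inr (by ring))
    have n5 := key (d₂ - d₁) _ h4 (Or.inr (by ring))
    have n6 := key (0 - d₁) _ h3 (Or.inr (by ring))
    have n6' := key (d₁ - 0) _ h3 (Or.inl (by ring))
    rintro (a | a) (b | b) h <;> fin_cases a <;> fin_cases b <;>
      first
        | rfl
        | exact absurd h ‹_›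
  · exact ((differentiable_thetaMat_apply τ V i j).comp (differentiable_id.sub_const _)).mul
      ((differentiable_sigma τ).comp (differentiable_id.sub_const _))
  · simp only
    rw [thetaMat_isUpperTriangular τ hV _ hij, zero_mul]
  · simp only [hc, Fin.prod_univ_two, Matrix.cons_val_zero, Matrix.cons_val_one, one_mul]
    congr 2
    ring
  · have e1 : ∀ a : ℂ, u + 1 - a = u - a + 1 := fun a => by ring
    simp only [e1, sigma_add_one, thetaMat_add_one]
  · have e1 : ∀ a : ℂ, u + τ - a = u - a + τ := fun a => by ring
    simp only [e1, sigma_add_tau, thetaMat_add_tau, Fin.prod_univ_two, Matrix.cons_val_zero,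
      Matrix.cons_val_one, sub_zero]
    rw [Matrix.mulVec_smul]
    ext i
    have hE : Complex.exp (-(2 * Real.pi * Complex.I * (u - (d₁ - d₂)))) *
        Complex.exp (-(2 * Real.pi * Complex.I * (u - d₂))) =
        Complex.exp (-(2 * Real.pi * Complex.I * u)) *
        Complex.exp (-(2 * Real.pi * Complex.I * (u - d₁))) := by
      rw [← Complex.exp_add, ← Complex.exp_add]
      congr 1
      ring
    have hE1 := Complex.exp_ne_zero (-(2 * Real.pi * Complex.I * u))
    have hE2 := Complex.exp_ne_zero (-(2 * Real.pi * Complex.I * (u - d₁)))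
    have hsum : V.val.mulVec (fun i => thetaMat τ V (u - (d₁ - d₂)) i j * sigma τ (u - d₂)) i =
        (V.val * thetaMat τ V (u - (d₁ - d₂))) i j * sigma τ (u - d₂) := by
      rw [Matrix.mul_apply, Finset.sum_mul]
      simp only [Matrix.mulVec, dotProduct]
      exact Finset.sum_congr rfl fun k _ => by ring
    simp only [Pi.smul_apply, Matrix.smul_apply, smul_eq_mul, hsum]
    generalize (V.val * thetaMat τ V (u - (d₁ - d₂))) i j = m
    generalize Complex.exp (-(2 * Real.pi * Complex.I * (u - (d₁ - d₂)))) = a at *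
    generalize Complex.exp (-(2 * Real.pi * Complex.I * (u - d₂))) = b at *
    generalize Complex.exp (-(2 * Real.pi * Complex.I * u)) = a' at *
    generalize Complex.exp (-(2 * Real.pi * Complex.I * (u - d₁))) = b' at *
    have h7 : (-a' * sigma τ u * (-b' * sigma τ (u - d₁)))⁻¹ * (-a * m * (-b * sigma τ (u - d₂))) =
        (a * b) * (a' * b')⁻¹ * ((sigma τ u * sigma τ (u - d₁))⁻¹ * (m * sigma τ (u - d₂))) := by
      simp only [mul_inv, inv_neg]
      ring
    rw [h7, hE, mul_inv_cancel₀ (mul_ne_zero hE1 hE2), one_mul]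

/-- For the least index, the basis vector is an eigenvector of the triangular `V`. Writing `c = m +
kτ`, its eigenvalue is `exp(-2πikτ)`, the multiplier of `exp(-2πiku)`. -/
theorem hasColumn_zero (hV : V.val.IsUpperTriangular) (hj : ∀ i, j ≤ i)
    (hVj : V.val j j = Complex.exp (-(2 * Real.pi * Complex.I * c)))
    (hcΛ : c ∈ lattice τ) : HasColumn τ V.val j 0 := by
  obtain ⟨⟨m, k⟩, hmk⟩ := hcΛ
  refine ⟨Fin.elim0, Fin.elim0,
    fun u => Pi.single j (Complex.exp (-(2 * Real.pi * Complex.I * (k * u)))),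
    fun u => Complex.exp (-(2 * Real.pi * Complex.I * (k * u))), ?_, fun i => ?_, by fun_prop,
    fun u => Complex.exp_ne_zero _, fun u i hij => ?_, fun u => by simp, fun u => ?_, fun u => ?_⟩
  · rintro (a | a) <;> exact a.elim0
  · by_cases h : i = j
    · subst h; simp only [Pi.single_eq_same]; fun_prop
    · simp [h]
  · simp [hij.ne']
  · have : Complex.exp (-(2 * Real.pi * Complex.I * (k * (u + 1)))) =
        Complex.exp (-(2 * Real.pi * Complex.I * (k * u))) := by
      rw [Complex.exp_eq_exp_iff_exists_int]
      exact ⟨-k, by push_cast; ring⟩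
    simp [this]
  · simp only [Finset.univ_eq_empty, Finset.prod_empty, inv_one, one_smul]
    ext i
    rw [Matrix.mulVec_single]
    by_cases h : i = j
    · subst h
      have : Complex.exp (-(2 * Real.pi * Complex.I * (k * (u + τ)))) =
          Complex.exp (-(2 * Real.pi * Complex.I * (k * u))) *
            Complex.exp (-(2 * Real.pi * Complex.I * c)) := by
        rw [← Complex.exp_add, Complex.exp_eq_exp_iff_exists_int]
        exact ⟨m, by rw [← hmk]; ring⟩
      simp [this, hVj, mul_comm (Complex.exp (-(2 * Real.pi * Complex.I * c)))]
    · have h1 : V.val i j = 0 := hV (lt_of_le_of_ne (hj i) (Ne.symm h))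
      simp [h, h1]

end Columns

/-! ### Intertwiners and the normal form of a flat factor. -/

section Intertwining

variable {τ : UpperHalfPlane} {n : Type} [Fintype n] [DecidableEq n]

/-- The lattice point `1`. -/
def latticeOne (τ : UpperHalfPlane) : lattice τ := ⟨1, one_mem_lattice τ⟩

/-- The lattice point `τ`. -/
def latticeTau (τ : UpperHalfPlane) : lattice τ := ⟨τ, tau_mem_lattice τ⟩

theorem FlatFactor.mat_add (ξ : FlatFactor τ n) (k l : lattice τ) :
    ξ.mat (k + l) = ξ.mat k * ξ.mat l := by
  simp only [FlatFactor.mat, ofAdd_add, map_mul, Units.val_mul]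

theorem FlatFactor.mat_mul_mat_neg (ξ : FlatFactor τ n) (l : lattice τ) :
    ξ.mat l * ξ.mat (-l) = 1 := by
  rw [← FlatFactor.mat_add, add_neg_cancel]
  simp [FlatFactor.mat]

theorem FlatFactor.mat_neg_mul_mat (ξ : FlatFactor τ n) (l : lattice τ) :
    ξ.mat (-l) * ξ.mat l = 1 := by
  rw [← FlatFactor.mat_add, neg_add_cancel]
  simp [FlatFactor.mat]

theorem FlatFactor.mat_mul_comm (ξ : FlatFactor τ n) (k l : lattice τ) :
    ξ.mat k * ξ.mat l = ξ.mat l * ξ.mat k := by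
  rw [← FlatFactor.mat_add, ← FlatFactor.mat_add, add_comm]

/-- Intertwining relations between factors of automorphy need only be checked on generators. -/
theorem intertwines_of_generators {ξ η : FlatFactor τ n} {h : ℂ → Matrix n n ℂ}
    (h1 : ∀ u, h (u + 1) * ξ.mat (latticeOne τ) = η.mat (latticeOne τ) * h u)
    (hτ : ∀ u, h (u + τ) * ξ.mat (latticeTau τ) = η.mat (latticeTau τ) * h u)
    (l : lattice τ) (u : ℂ) : h (u + l) * ξ.mat l = η.mat l * h u := by
  obtain ⟨l, hl⟩ := l
  refine lattice_induction (p := fun l => ∀ hl : l ∈ lattice τ, ∀ u,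
    h (u + l) * ξ.mat ⟨l, hl⟩ = η.mat ⟨l, hl⟩ * h u) (fun _ => h1) (fun _ => hτ) ?_ ?_ hl hl u
  · intro a ha b hb iha ihb hab u
    have e : (⟨a + b, hab⟩ : lattice τ) = ⟨b, hb⟩ + ⟨a, ha⟩ := Subtype.ext (add_comm a b)
    rw [e, FlatFactor.mat_add, FlatFactor.mat_add, ← add_assoc, ← mul_assoc, ihb hb, mul_assoc,
      iha ha, mul_assoc]
  · intro a ha iha hna u
    have e : (⟨-a, hna⟩ : lattice τ) = -⟨a, ha⟩ := rfl
    have h2 := iha ha (u + -a)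
    rw [neg_add_cancel_right] at h2
    rw [e]
    calc h (u + -a) * ξ.mat (-⟨a, ha⟩)
        = (η.mat (-⟨a, ha⟩) * η.mat ⟨a, ha⟩) * (h (u + -a) * ξ.mat (-⟨a, ha⟩)) := by
          rw [FlatFactor.mat_neg_mul_mat, one_mul]
      _ = η.mat (-⟨a, ha⟩) * (h u * (ξ.mat ⟨a, ha⟩ * ξ.mat (-⟨a, ha⟩))) := by
          rw [← mul_assoc (h u), h2]; simp only [mul_assoc]
      _ = η.mat (-⟨a, ha⟩) * h u := by rw [FlatFactor.mat_mul_mat_neg, mul_one]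

theorem normalizedFactor_mat_one (V : GL n ℂ) :
    (normalizedFactor τ V).mat (latticeOne τ) = 1 := by
  have h : tauCoord τ (latticeOne τ) = 0 := tauCoord_spec τ _ 1 0 (by simp [latticeOne])
  change ((V ^ tauCoord τ (latticeOne τ) : GL n ℂ) : Matrix n n ℂ) = 1
  rw [h, zpow_zero, Units.val_one]

theorem normalizedFactor_mat_tau (V : GL n ℂ) :
    (normalizedFactor τ V).mat (latticeTau τ) = V.val := by
  have h : tauCoord τ (latticeTau τ) = 1 := tauCoord_spec τ _ 0 1 (by simp [latticeTau])
  change ((V ^ tauCoord τ (latticeTau τ) : GL n ℂ) : Matrix n n ℂ) = V.val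
  rw [h, zpow_one]

theorem FlatFactor.Equivalent.trans {ξ η ζ : FlatFactor τ n} (h₁ : ξ.Equivalent η)
    (h₂ : η.Equivalent ζ) : ξ.Equivalent ζ := by
  obtain ⟨f, hf, hfe⟩ := h₁
  obtain ⟨g, hg, hge⟩ := h₂
  refine ⟨fun u => g u * f u, fun i j => ?_, fun l u => ?_⟩
  · simp only [Units.val_mul, Matrix.mul_apply]
    exact Differentiable.fun_sum fun k _ => (hg i k).mul (hf k j)
  · rw [Units.val_mul, Units.val_mul, mul_assoc, hfe, ← mul_assoc, hge, mul_assoc]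

end Intertwining

/-- An invertible element of a Banach algebra with countable spectrum is the value at `1` of an
entire one-parameter group in its bicommutant. -/
theorem exists_oneParameterGroup {𝔸 : Type*} [NormedRing 𝔸] [NormedAlgebra ℂ 𝔸] [CompleteSpace 𝔸]
    (a : 𝔸) (ha : IsUnit a) (hs : (spectrum ℂ a).Countable) :
    ∃ E : ℂ → 𝔸ˣ, Differentiable ℂ (fun u => (E u : 𝔸)) ∧ (∀ u v, E (u + v) = E u * E v) ∧
      (E 1 : 𝔸) = a ∧ ∀ b, Commute a b → ∀ u, Commute (E u : 𝔸) b := by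
  obtain ⟨L, hL, hLc⟩ := exists_exp_eq_of_isUnit a ha hs
  have hadd : ∀ u v : ℂ, NormedSpace.exp ((u + v) • L) =
      NormedSpace.exp (u • L) * NormedSpace.exp (v • L) := by
    intro u v
    let _ : NormedAlgebra ℚ 𝔸 := NormedAlgebra.restrictScalars ℚ ℂ 𝔸
    rw [add_smul]
    exact NormedSpace.exp_add_of_commute (((Commute.refl L).smul_left u).smul_right v)
  refine ⟨fun u => ⟨NormedSpace.exp (u • L), NormedSpace.exp ((-u) • L), ?_, ?_⟩, fun u => ?_,
    fun u v => Units.ext (hadd u v), ?_, fun b hb u => ?_⟩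
  · rw [← hadd, add_neg_cancel, zero_smul, NormedSpace.exp_zero]
  · rw [← hadd, neg_add_cancel, zero_smul, NormedSpace.exp_zero]
  · exact (hasDerivAt_exp_smul_const L u).differentiableAt
  · simpa using hL
  · exact ((hLc b hb).smul_left u).exp_left

theorem exists_oneParameterGroup_matrix {r : ℕ} (A : GL (Fin r) ℂ) :
    ∃ E : ℂ → GL (Fin r) ℂ, (∀ i j, Differentiable ℂ fun u => (E u).val i j) ∧
      (∀ u v, E (u + v) = E u * E v) ∧ E 1 = A ∧
      ∀ B : GL (Fin r) ℂ, A * B = B * A → ∀ u, E u * B = B * E u := by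
  obtain ⟨E, hd, hadd, h1, hc⟩ := exists_oneParameterGroup A.val A.isUnit
    A.val.finite_spectrum.countable
  refine ⟨E, fun i j => ?_, hadd, Units.ext h1, fun B hB u =>
    Units.ext (hc B.val (congrArg Units.val hB) u)⟩
  let L : Matrix (Fin r) (Fin r) ℂ →L[ℂ] ℂ :=
    ⟨Matrix.entryLinearMap ℂ ℂ i j, continuous_id.matrix_elem i j⟩
  exact L.differentiable.comp hd

/-- Every flat factor of automorphy is equivalent to a normalized one with upper triangular
matrix. -/
theorem exists_equivalent_normalizedFactor {τ : UpperHalfPlane} {r : ℕ}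
    (ξ : FlatFactor τ (Fin r)) :
    ∃ V : GL (Fin r) ℂ, V.val.IsUpperTriangular ∧ ξ.Equivalent (normalizedFactor τ V) := by
  set A : GL (Fin r) ℂ := ξ (Multiplicative.ofAdd (latticeOne τ)) with hA
  set B : GL (Fin r) ℂ := ξ (Multiplicative.ofAdd (latticeTau τ)) with hB
  have hAB : A * B = B * A := Units.ext (FlatFactor.mat_mul_comm ξ _ _)
  obtain ⟨E, hEd, hadd, hE1, hEB⟩ := exists_oneParameterGroup_matrix A
  -- The gauge `E (-u)` makes the matrix at `1` trivial, and `E (-τ) * B` is then the matrix at `τ`,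
  -- because `E` commutes with `B`.
  obtain ⟨P, U, hU, hP⟩ := exists_conj_isUpperTriangular r (E (-τ) * B).val
  have hV : (P * (E (-τ) * B) * P⁻¹).val = U := by
    rw [Units.val_mul, Units.val_mul, hP, mul_assoc, ← Units.val_mul, mul_inv_cancel,
      Units.val_one, mul_one]
  have h1 : ∀ u, P * E (-(u + 1)) * A = P * E (-u) := by
    intro u
    rw [← hE1, mul_assoc, ← hadd]
    congr 2
    ring
  have h2 : ∀ u, P * E (-(u + τ)) * B = P * (E (-τ) * B) * P⁻¹ * (P * E (-u)) := by
    intro u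
    rw [neg_add_rev, hadd, mul_assoc, mul_assoc (E (-τ)), hEB B hAB (-u)]
    group
  refine ⟨P * (E (-τ) * B) * P⁻¹, by rw [hV]; exact hU, fun u => P * E (-u), fun i j => ?_,
    intertwines_of_generators (h := fun u => (P * E (-u)).val) (fun u => ?_) fun u => ?_⟩
  · simp only [Units.val_mul, Matrix.mul_apply]
    exact Differentiable.fun_sum fun k _ => (differentiable_const _).mul
      ((hEd k j).comp differentiable_neg)
  · rw [normalizedFactor_mat_one, one_mul]
    exact congrArg Units.val (h1 u)
  · rw [normalizedFactor_mat_tau]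
    exact congrArg Units.val (h2 u)

/-! ### Assembling translated columns into a trivialization. -/

theorem exists_translations (τ : UpperHalfPlane) {S : Set ℂ} (hS : S.Countable) :
    ∃ d : ℂ, ∀ m : ℤ, m ≠ 0 → ∀ a ∈ S, ∀ b ∈ S, m * d + a - b ∉ lattice τ := by
  have h : ((fun x : ℂ × ℂ × ℂ => x.1 + x.2.2 - x.2.1) ''
      ((lattice τ : Set ℂ) ×ˢ (S ×ˢ S))).Countable :=
    ((countable_lattice τ).prod (hS.prod hS)).image _
  obtain ⟨d, hd⟩ := exists_forall_notMem_of_countable h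
  refine ⟨d, fun m hm a ha b hb hmem => hd m hm ?_⟩
  exact ⟨(m * d + a - b, a, b), ⟨hmem, ha, hb⟩, by simp⟩

theorem prod_filter_finSigmaFinEquiv {r : ℕ} (n : Fin r → ℕ) (f : (Σ i, Fin (n i)) → ℂ)
    (j : Fin r) : ∏ k with (finSigmaFinEquiv.symm k : Σ i, Fin (n i)).1 = j,
      f (finSigmaFinEquiv.symm k) = ∏ k, f ⟨j, k⟩ := by
  rw [Finset.prod_filter,
    Equiv.prod_comp finSigmaFinEquiv.symm fun x : Σ i, Fin (n i) => if x.1 = j then f x else 1,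
    Fintype.prod_sigma]
  simp only
  rw [Finset.prod_eq_single j (fun i _ hi => by simp [hi]) (by simp)]
  simp

/-- Since the multipliers of `ξ_V` do not depend on `u`, translating each column separately
preserves automorphy and triangularity, while generic translations make the points of different
columns incongruent. -/
theorem exists_interpolates_of_hasColumn {τ : UpperHalfPlane} {r : ℕ} {ξ : FlatFactor τ (Fin r)}
    {V : GL (Fin r) ℂ} (hξ : ξ.Equivalent (normalizedFactor τ V)) (n : Fin r → ℕ)
    (hcol : ∀ j, HasColumn τ V.val j (n j)) :
    ∃ (D : SimpleNullPoleData τ r (∑ j, n j)) (F : ℂ → Matrix (Fin r) (Fin r) ℂ),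
      IsTrivialization ξ F ∧ Interpolates D F := by
  choose z w g e hdist hg he he0 htri hdiag hone htau using hcol
  obtain ⟨h, hh, hhe⟩ := hξ
  let S : Set ℂ := Set.range fun x : Σ j, Fin (n j) ⊕ Fin (n j) => Sum.elim (z x.1) (w x.1) x.2
  obtain ⟨d, hd⟩ := exists_translations τ (S := S) (Set.countable_range _)
  -- Multiples of one generic `d` suffice: two columns differ by a nonzero integer multiple of `d`.
  let t : Fin r → ℂ := fun j => (j : ℕ) * d
  let ε : Fin (∑ j, n j) ≃ Σ j, Fin (n j) := finSigmaFinEquiv.symm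
  let Z : Fin (∑ j, n j) → ℂ := fun k => t (ε k).1 + z (ε k).1 (ε k).2
  let W : Fin (∑ j, n j) → ℂ := fun k => t (ε k).1 + w (ε k).1 (ε k).2
  let col : Fin (∑ j, n j) → Fin r := fun k => (ε k).1
  let G₀ : ℂ → Matrix (Fin r) (Fin r) ℂ := fun u => Matrix.of fun i j => g j (u - t j) i
  -- The inverse of the equivalence carries sections of `ξ_V` back to sections of `ξ` without
  -- changing zeros or poles of the determinant.
  let H : ℂ → Matrix (Fin r) (Fin r) ℂ := fun u => (h u).val⁻¹
  let G : ℂ → Matrix (Fin r) (Fin r) ℂ := fun u => H u * G₀ u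
  have hHd : ∀ i j, Differentiable ℂ fun u => H u i j := fun i j u =>
    (analyticAt_nonsing_inv (fun a b => (hh a b).analyticAt u)
      ((Matrix.isUnit_iff_isUnit_det _).1 (h u).isUnit).ne_zero i j).differentiableAt
  have hHdet : ∀ u, (H u).det ≠ 0 := fun u =>
    (Matrix.isUnit_nonsing_inv_det _ ((Matrix.isUnit_iff_isUnit_det _).1 (h u).isUnit)).ne_zero
  have hG₀ : ∀ i j, Differentiable ℂ fun u => G₀ u i j := fun i j =>
    (hg j i).comp (differentiable_id.sub_const (t j))
  have hG : ∀ i j, Differentiable ℂ fun u => G u i j := by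
    intro i j
    simp only [G, Matrix.mul_apply]
    exact Differentiable.fun_sum fun k _ => (hHd i k).mul (hG₀ k j)
  have hdivW : ∀ u j, ∏ k with col k = j, sigma τ (u - W k) =
      ∏ k, sigma τ (u - t j - w j k) := by
    intro u j
    refine (prod_filter_finSigmaFinEquiv n (fun x => sigma τ (u - (t x.1 + w x.1 x.2))) j).trans ?_
    simp only [sub_sub]
  have hF₀apply : ∀ u i j, divColumns τ G₀ W col u i j =
      ((∏ k, sigma τ (u - t j - w j k))⁻¹ • g j (u - t j)) i := by
    intro u i j
    rw [divColumns_apply, hdivW, Pi.smul_apply, smul_eq_mul, mul_comm]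
    rfl
  have hF₀ : ∀ (l : lattice τ) (u : ℂ), divColumns τ G₀ W col (u + l) =
      (normalizedFactor τ V).mat l * divColumns τ G₀ W col u := by
    intro l u
    -- Automorphy is intertwining with the trivial factor as source, so it is enough to check the
    -- periods `1` and `τ`.
    have key := intertwines_of_generators (ξ := (1 : FlatFactor τ (Fin r)))
      (η := normalizedFactor τ V) (h := divColumns τ G₀ W col) (fun u => ?_) (fun u => ?_) l u
    · simpa [FlatFactor.mat] using key
    · rw [normalizedFactor_mat_one, one_mul]
      simp only [FlatFactor.mat, MonoidHom.one_apply, Units.val_one, mul_one]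
      ext i j
      rw [hF₀apply, hF₀apply, show u + 1 - t j = u - t j + 1 by ring]
      exact congrFun (hone j (u - t j)) i
    · rw [normalizedFactor_mat_tau]
      simp only [FlatFactor.mat, MonoidHom.one_apply, Units.val_one, mul_one]
      ext i j
      rw [hF₀apply, Matrix.mul_apply]
      simp only [hF₀apply]
      have := congrFun (htau j (u - t j)) i
      simp only [show u + τ - t j = u - t j + τ by ring]
      exact this
  have hFmul : ∀ u, divColumns τ G W col u = H u * divColumns τ G₀ W col u := by
    intro u
    rw [divColumns, divColumns, mul_assoc]
  refine exists_interpolates_divColumns (G := G) (z := Z) (w := W) (col := col)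
    (e := fun u => (H u).det * ∏ j, e j (u - t j)) hG (fun u => ?_) (fun u => ?_) (fun u => ?_) ?_
    fun l u => ?_
  · refine (analyticAt_det fun i j => (hHd i j).analyticAt u).differentiableAt.mul ?_
    exact DifferentiableAt.fun_finsetProd fun j _ =>
      ((he j).comp (differentiable_id.sub_const (t j))) u
  · exact mul_ne_zero (hHdet u) (Finset.prod_ne_zero_iff.2 fun j _ => he0 j _)
  · have htriG : (G₀ u).IsUpperTriangular := fun i j hij => htri j (u - t j) i hij
    have hZ : ∏ k, sigma τ (u - Z k) = ∏ j, ∏ k, sigma τ (u - t j - z j k) := by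
      rw [Equiv.prod_comp ε fun x => sigma τ (u - (t x.1 + z x.1 x.2)), Fintype.prod_sigma]
      simp only [sub_sub]
    rw [Matrix.det_mul, Matrix.det_of_isUpperTriangular htriG, hZ, mul_assoc,
      ← Finset.prod_mul_distrib]
    congr 1
    exact Finset.prod_congr rfl fun j _ => hdiag j (u - t j)
  · have helim : ∀ a, ∃ (j : Fin r) (b : Fin (n j) ⊕ Fin (n j)),
        Sum.elim Z W a = t j + Sum.elim (z j) (w j) b ∧
        a = Sum.map (fun k => ε.symm ⟨j, k⟩) (fun k => ε.symm ⟨j, k⟩) b := by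
      rintro (k | k)
      · exact ⟨(ε k).1, Sum.inl (ε k).2, rfl, by simp⟩
      · exact ⟨(ε k).1, Sum.inr (ε k).2, rfl, by simp⟩
    intro a b hab
    obtain ⟨j, a', ha, rfl⟩ := helim a
    obtain ⟨j', b', hb, rfl⟩ := helim b
    rw [ha, hb] at hab
    by_cases hj : j = j'
    · subst hj
      rw [hdist j a' b' (by simpa using hab)]
    · exfalso
      refine hd ((j : ℤ) - (j' : ℤ)) (fun h0 => hj (Fin.ext (by omega))) _ ⟨⟨j, a'⟩, rfl⟩ _
        ⟨⟨j', b'⟩, rfl⟩ ?_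
      convert hab using 1
      simp only [t]
      push_cast
      ring
  · rw [hFmul, hFmul, hF₀]
    have h1 := hhe l u
    have hu := (Matrix.isUnit_iff_isUnit_det _).1 (h u).isUnit
    have hul := (Matrix.isUnit_iff_isUnit_det _).1 (h (u + l)).isUnit
    have h2 : H (u + l) * (normalizedFactor τ V).mat l = ξ.mat l * H u := by
      calc H (u + l) * (normalizedFactor τ V).mat l
          = H (u + l) * ((normalizedFactor τ V).mat l * ((h u).val * (h u).val⁻¹)) := by
            rw [Matrix.mul_nonsing_inv _ hu, mul_one]
        _ = (H (u + l) * (h (u + l)).val) * (ξ.mat l * H u) := by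
            rw [← mul_assoc _ (h u).val, ← h1]; simp only [H, mul_assoc]
        _ = _ := by rw [Matrix.nonsing_inv_mul _ hul, one_mul]
    rw [← mul_assoc, h2, mul_assoc]

/-! ### Eigenvalues coming from lattice points give Jordan summands. -/

/-- A normalized flat factor whose matrix has an eigenvalue `exp (-2πi c)` with `c` in the lattice
has a direct summand given by a Jordan block with eigenvalue `1`. -/
theorem hasSummand_of_det_eq_zero {τ : UpperHalfPlane} {r : ℕ} {ξ : FlatFactor τ (Fin r)}
    {V : GL (Fin r) ℂ} (hξ : ξ.Equivalent (normalizedFactor τ V)) {c : ℂ} (hc : c ∈ lattice τ)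
    (hdet : (V.val - Complex.exp (-(2 * Real.pi * Complex.I * c)) •
      (1 : Matrix (Fin r) (Fin r) ℂ)).det = 0) :
    ∃ s : ℕ, 1 ≤ s ∧ ξ.HasSummand (jordanFactor τ s 1) := by
  obtain ⟨⟨m, k⟩, rfl⟩ := hc
  set α := Complex.exp (2 * Real.pi * Complex.I * (k * τ)) with hα
  have hα' : Complex.exp (-(2 * Real.pi * Complex.I * ((m : ℂ) + k * τ))) = α⁻¹ := by
    rw [hα, ← Complex.exp_neg, Complex.exp_eq_exp_iff_exists_int]
    exact ⟨-m, by push_cast; ring⟩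
  have hα0 : α ≠ 0 := Complex.exp_ne_zero _
  simp only [hα'] at hdet
  -- The eigenvalue of `V` is `α⁻¹`, so `α • V` has eigenvalue `1`.
  have hdet' : (α • V.val - (1 : ℂ) • (1 : Matrix (Fin r) (Fin r) ℂ)).det = 0 := by
    have : α • V.val - (1 : ℂ) • (1 : Matrix (Fin r) (Fin r) ℂ) =
        α • (V.val - α⁻¹ • (1 : Matrix (Fin r) (Fin r) ℂ)) := by
      rw [smul_sub, smul_smul, mul_inv_cancel₀ hα0]
    rw [this, Matrix.det_smul, hdet, mul_zero]
  obtain ⟨s, t, hst, P, T', hs, hP⟩ := exists_jordanBlock_summand _ 1 hdet'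
  have hT' : T'.det ≠ 0 := by
    intro h0
    have h1 := congrArg Matrix.det hP
    rw [Matrix.det_mul, Matrix.det_mul, Matrix.det_reindex_self, Matrix.det_fromBlocks_zero₂₁, h0,
      mul_zero, zero_mul, Matrix.det_smul] at h1
    have hPd := ((Matrix.isUnit_iff_isUnit_det _).1 P.isUnit).ne_zero
    have hVd := ((Matrix.isUnit_iff_isUnit_det _).1 V.isUnit).ne_zero
    exact mul_ne_zero hPd (mul_ne_zero (pow_ne_zero _ hα0) hVd) h1
  let TG : GL (Fin t) ℂ := Matrix.GeneralLinearGroup.mkOfDetNeZero T' hT'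
  refine ⟨s, hs, t, blockEquiv hst, normalizedFactor τ TG, hξ.trans ?_⟩
  -- The scalar gauge `exp(2πiku)` has period `1` and multiplier `α` at `τ`, so it makes `ξ_V`
  -- equivalent to `ξ_{αV}`.
  let x : ℂ → ℂˣ := fun u => Units.mk0 (Complex.exp (2 * Real.pi * Complex.I * (k * u)))
    (Complex.exp_ne_zero _)
  refine ⟨fun u => x u • P, fun i j => ?_, intertwines_of_generators
    (h := fun u => (x u • P).val) (fun u => ?_) fun u => ?_⟩
  · change Differentiable ℂ fun u => Complex.exp (2 * Real.pi * Complex.I * (k * u)) * P.val i j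
    fun_prop
  · have h1 : (((jordanFactor τ s 1).directSum (normalizedFactor τ TG)).reindex
        (blockEquiv hst)).mat (latticeOne τ) = Matrix.reindex (blockEquiv hst) (blockEquiv hst)
          (Matrix.fromBlocks ((jordanFactor τ s 1).mat (latticeOne τ)) 0 0
            ((normalizedFactor τ TG).mat (latticeOne τ))) := rfl
    have h2 : x (u + 1) = x u := by
      ext
      simp only [x, Units.val_mk0]
      rw [Complex.exp_eq_exp_iff_exists_int]
      exact ⟨k, by ring⟩
    rw [h1, jordanFactor, normalizedFactor_mat_one, normalizedFactor_mat_one,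
      normalizedFactor_mat_one, h2, Matrix.fromBlocks_one, Matrix.reindex_apply,
      Matrix.submatrix_one_equiv, one_mul, mul_one]
  · have h1 : (((jordanFactor τ s 1).directSum (normalizedFactor τ TG)).reindex
        (blockEquiv hst)).mat (latticeTau τ) = Matrix.reindex (blockEquiv hst) (blockEquiv hst)
          (Matrix.fromBlocks ((jordanFactor τ s 1).mat (latticeTau τ)) 0 0
            ((normalizedFactor τ TG).mat (latticeTau τ))) := rfl
    have h2 : ∀ u, (x u • P).val = Complex.exp (2 * Real.pi * Complex.I * (k * u)) • P.val :=
      fun _ => rfl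
    have h3 : Complex.exp (2 * Real.pi * Complex.I * (k * (u + τ))) =
        Complex.exp (2 * Real.pi * Complex.I * (k * u)) * α := by
      rw [hα, ← Complex.exp_add]; congr 1; ring
    rw [h1, jordanFactor, normalizedFactor_mat_tau, normalizedFactor_mat_tau,
      normalizedFactor_mat_tau, h2, h2, h3, mul_smul_comm]
    have h4 : (jordanGL s 1).val = jordanBlock s 1 := rfl
    have h5 : TG.val = T' := rfl
    rw [h4, h5, ← hP, mul_smul_comm, smul_smul, smul_mul_assoc]

end

end EllipticFlat

theorem mainTheorem4 (τ : UpperHalfPlane) (r : ℕ) (hr : 1 ≤ r)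
    (ξ : EllipticFlat.FlatFactor τ (Fin r)) :
    (∃ N : ℕ, N < 2 * r ∧ ∃ (D : EllipticFlat.SimpleNullPoleData τ r N)
        (F : ℂ → Matrix (Fin r) (Fin r) ℂ),
        EllipticFlat.IsTrivialization ξ F ∧ EllipticFlat.Interpolates D F) ∧
    ((¬ ∃ s : ℕ, 1 ≤ s ∧
        EllipticFlat.FlatFactor.HasSummand ξ (EllipticFlat.jordanFactor τ s 1)) →
      ∃ (D : EllipticFlat.SimpleNullPoleData τ r r) (F : ℂ → Matrix (Fin r) (Fin r) ℂ),
        EllipticFlat.IsTrivialization ξ F ∧ EllipticFlat.Interpolates D F) := by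
  obtain ⟨V, hV, hξ⟩ := EllipticFlat.exists_equivalent_normalizedFactor ξ
  choose c hc hdiag using EllipticFlat.exists_thetaMat_diag τ hV
  constructor
  · let j₀ : Fin r := ⟨0, hr⟩
    obtain ⟨n₀, hn₀, hcol₀⟩ : ∃ n₀ ≤ 1, EllipticFlat.HasColumn τ V.val j₀ n₀ := by
      by_cases h : c j₀ ∈ EllipticFlat.lattice τ
      · exact ⟨0, zero_le_one, EllipticFlat.hasColumn_zero hV (fun i => Nat.zero_le i) (hc j₀) h⟩
      · exact ⟨1, le_rfl, EllipticFlat.hasColumn_one hV (hdiag j₀) h⟩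
    -- The saving in the first column makes the total at most `2r - 1`; two zeros are allowed in
    -- every other column, whatever `c j` is.
    let n : Fin r → ℕ := fun j => if j = j₀ then n₀ else 2
    refine ⟨∑ j, n j, ?_, EllipticFlat.exists_interpolates_of_hasColumn hξ n fun j => ?_⟩
    · have h1 : ∑ j, n j < ∑ _j : Fin r, 2 := by
        refine Finset.sum_lt_sum (fun j _ => ?_) ⟨j₀, Finset.mem_univ _, ?_⟩
        · simp only [n]; split_ifs <;> omega
        · simp only [n, if_true]; omega
      simpa [mul_comm] using h1
    · by_cases h : j = j₀
      · subst h; simpa [n] using hcol₀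
      · simpa [n, h] using EllipticFlat.hasColumn_two hV (hdiag j)
  · intro hsummand
    have hcol : ∀ j, EllipticFlat.HasColumn τ V.val j 1 := by
      intro j
      -- If `c j` were in the lattice, the eigenvalue `V j j` would produce an excluded Jordan
      -- summand.
      refine EllipticFlat.hasColumn_one hV (hdiag j) fun h => hsummand ?_
      refine EllipticFlat.hasSummand_of_det_eq_zero hξ h ?_
      rw [← hc j]
      rw [Matrix.det_of_isUpperTriangular]
      · exact Finset.prod_eq_zero (Finset.mem_univ j) (by simp)
      · intro i k hik
        have hik' : k < i := hik
        simp [hV hik, hik'.ne']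
    have := EllipticFlat.exists_interpolates_of_hasColumn hξ (fun _ => 1) hcol
    rwa [Finset.sum_const, Finset.card_univ, Fintype.card_fin, smul_eq_mul, mul_one] at this
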